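/- An instance of Max Happy Vertices consists of a finite simple undirected graph $G=(V,E)$, a number of colors $\ell$, a partial coloring $p\colon S\to[\ell]$ for some $S\subseteq V$, and a positive integer $k$; here $n=|V|$, $\ell$ and $k$ are all part of the input. A vertex $v$ is happy with respect to a coloring $c\colon V\to[\ell]$ if $c(u)=c(v)$ for every neighbor $u$ of $v$. The question is whether there is a coloring $c\colon V\to[\ell]$ extending $p$ with respect to which at least $k$ vertices of $G$ are happy. A cograph is a graph with no induced path on four vertices. Theorem. Max Happy Vertices is solvable in polynomial time on cographs: there are a (deterministic, multi-stack) Turing machine $M$ and a polynomial $q$ such that for every instance $I=(G,\ell,p,k)$ in which $G$ is a cograph, $M$, started on the encoding of $I$ (the graph by the rows of its adjacency matrix, the numbers $\ell$, $k$ and the precolors in binary), halts within $q(|I|)$ steps, where $|I|$ is the length of the encoding, and outputs the correct answer to the question. -/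

import Mathlib

/-- A cograph: a graph with no induced path on four vertices. -/
def IsCograph {V : Type} (G : SimpleGraph V) : Prop :=
  ¬ (SimpleGraph.pathGraph 4).IsIndContained G

/-- An instance of Max Happy Vertices: a finite simple graph (vertex set `Fin n`), a number `ℓ` of
colors, a partial coloring `p` (`p v = none` means that `v` is not precolored) and a positive
integer `k`. All of `n`, `ℓ`, `k` are part of the input. -/
structure MHVInstance : Type where
  n : ℕ
  graph : SimpleGraph (Fin n)
  ℓ : ℕ
  p : Fin n → Option (Fin ℓ)
  k : ℕ
  k_pos : 0 < k

/-- The vertex `v` is happy with respect to `c`: all its neighbors have its color. -/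
def IsHappy {V C : Type} (G : SimpleGraph V) (c : V → C) (v : V) : Prop :=
  ∀ u, G.Adj v u → c u = c v

/-- The total coloring `c` extends the partial coloring `p`. -/
def ExtendsColoring {V C : Type} (p : V → Option C) (c : V → C) : Prop :=
  ∀ v a, p v = some a → c v = a

namespace MHVInstance

/-- Some coloring extending the precoloring makes at least `k` vertices happy. -/
def IsYes (I : MHVInstance) : Prop :=
  ∃ c : Fin I.n → Fin I.ℓ, ExtendsColoring I.p c ∧ I.k ≤ {v | IsHappy I.graph c v}.ncard

open Classical in
/-- The answer to the decision problem. -/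
noncomputable def answer (I : MHVInstance) : Bool := decide I.IsYes

open Computability in
/-- The precolor of a vertex: a number in binary, or a blank if there is none. -/
def encodeColor {ℓ : ℕ} : Option (Fin ℓ) → List Γ'
  | none => [Γ'.blank]
  | some a => (encodeNat a).map Γ'.bit

open Classical Computability in
/-- The entry of a vertex `v`: its precolor, then its row of the adjacency matrix. -/
noncomputable def encodeVertex (I : MHVInstance) (v : Fin I.n) : List Γ' :=
  [Γ'.bra] ++ encodeColor (I.p v) ++ [Γ'.comma] ++
    (List.finRange I.n).map (fun u => Γ'.bit (decide (I.graph.Adj v u))) ++ [Γ'.ket]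

open Computability in
/-- The input string: `ℓ` and `k` in binary, then the entries of the vertices in turn. -/
noncomputable def encode (I : MHVInstance) : List Γ' :=
  (encodeNat I.ℓ).map Γ'.bit ++ [Γ'.comma] ++ (encodeNat I.k).map Γ'.bit ++ [Γ'.comma] ++
    (List.finRange I.n).flatMap I.encodeVertex

end MHVInstance

/-! In a graph without induced path on four vertices, a walk of three edges can always be shortened,
so two vertices of one component are at distance at most two (`Near.trans`). Two happy vertices at
distance at most two share a color, because each of them forces its color on its neighbors
(`color_eq_of_near`). Hence all happy vertices of a component have one common color.

For a fixed common color, a vertex of the component can be happy only if its closed neighborhood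
carries no other precolor, and all such vertices become happy together when the uncolored vertices
of the component receive that color. Only the precolors occurring in the component matter: a color
that does not occur there saves only the vertices with uncolored closed neighborhood, and these are
compatible with every choice. So the optimum `best` of a component is a maximum over its vertices
`w`, whose precolors serve as candidate colors. Components are independent, and the answer is yes
iff there is a color at all and `k` is at most the sum of these optima (`isYes_iff`).

This criterion is evaluated by a Turing machine obtained by compiling structured stack programs to
`TM2` (`Runs.steps`). The condition "`i` represents a component and `t < best i`" is a first-order
formula with counting over eight vertex variables (`Formula.main`). Any fixed such formula is
evaluated by nested loops in polynomial time (`Formula.exists_exec`). Running over all pairs `(i,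
t)` and subtracting one from the binary number `k` for each pair that satisfies the formula leaves
`k` minus the optimum, truncated at zero (`exists_exec_loops`); the machine then tests for zero. -/

open Computability Turing Function

/-! ### Structured stack programs and their step-counting semantics. -/

/-- Structured programs over stacks indexed by `K`, with alphabet `Γ'`. The tests of `ite` and
`loop` read the top symbol of a stack. -/
inductive StackProg (K : Type) : Type
  | skip : StackProg K
  | push (k : K) (s : Γ') : StackProg K
  | drop (k : K) : StackProg K
  | copy (a b : K) : StackProg K
  | seq (P Q : StackProg K) : StackProg K
  | ite (k : K) (b : Option Γ' → Bool) (P Q : StackProg K) : StackProg K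
  | loop (k : K) (b : Option Γ' → Bool) (P : StackProg K) : StackProg K

namespace StackProg

variable {K : Type}

/-- Run two programs in turn. -/
infixr:60 " ⨟ " => StackProg.seq

/-- `Runs P S S' t`: started on the stacks `S`, the program `P` ends with `S'` after `t` steps. -/
inductive Runs [DecidableEq K] :
    StackProg K → (K → List Γ') → (K → List Γ') → ℕ → Prop
  | skip (S) : Runs skip S S 1
  | push (k s S) : Runs (push k s) S (update S k (s :: S k)) 1
  | drop (k S) : Runs (drop k) S (update S k (S k).tail) 1
  | copy (a b S) : Runs (copy a b) S (update S b ((S a).head?.getD Γ'.blank :: S b)) 1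
  | seq {P Q S₁ S₂ S₃ t₁ t₂} : Runs P S₁ S₂ t₁ → Runs Q S₂ S₃ t₂ → Runs (seq P Q) S₁ S₃ (t₁ + t₂)
  | ite_true {k b P Q S S' t} : b (S k).head? = true → Runs P S S' t →
      Runs (ite k b P Q) S S' (1 + t)
  | ite_false {k b P Q S S' t} : b (S k).head? = false → Runs Q S S' t →
      Runs (ite k b P Q) S S' (1 + t)
  | loop_end {k b P S} : b (S k).head? = false → Runs (loop k b P) S S 1
  | loop_step {k b P S₁ S₂ S₃ t₁ t₂} : b (S₁ k).head? = true → Runs P S₁ S₂ t₁ →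
      Runs (loop k b P) S₂ S₃ t₂ → Runs (loop k b P) S₁ S₃ (1 + t₁ + t₂)

/-! ### Compilation to `TM2` -/

/-- The labels of the compiled program. -/
def Lab : StackProg K → Type
  | seq P Q => Lab P ⊕ Lab Q
  | ite _ _ P Q => Option (Lab P ⊕ Lab Q)
  | loop _ _ P => Option (Lab P)
  | _ => Unit

instance fintypeLab : (P : StackProg K) → Fintype (Lab P)
  | skip => inferInstanceAs (Fintype Unit)
  | push _ _ => inferInstanceAs (Fintype Unit)
  | drop _ => inferInstanceAs (Fintype Unit)
  | copy _ _ => inferInstanceAs (Fintype Unit)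
  | seq P Q =>
    letI := fintypeLab P
    letI := fintypeLab Q
    inferInstanceAs (Fintype (Lab P ⊕ Lab Q))
  | ite _ _ P Q =>
    letI := fintypeLab P
    letI := fintypeLab Q
    inferInstanceAs (Fintype (Option (Lab P ⊕ Lab Q)))
  | loop _ _ P =>
    letI := fintypeLab P
    inferInstanceAs (Fintype (Option (Lab P)))

/-- The label at which the compiled program starts. -/
def entry : (P : StackProg K) → Lab P
  | skip => ()
  | push _ _ => ()
  | drop _ => ()
  | copy _ _ => ()
  | seq P _ => Sum.inl (entry P)
  | ite _ _ _ _ => none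
  | loop _ _ _ => none

/-- The alphabets of the machine: the stack `none` is the output stack. -/
abbrev alphabet : Option K → Type
  | none => Bool
  | some _ => Γ'

/-- The statements of the machine. -/
abbrev MStmt (K Λ : Type) := TM2.Stmt (alphabet (K := K)) Λ (Option Γ')

/-- Put the top of a stack into the register. -/
def peekTop {Λ : Type} (k : K) (q : MStmt K Λ) : MStmt K Λ :=
  TM2.Stmt.peek (some k) (fun _ (o : Option Γ') => o) q

/-- The code of a program whose labels are embedded into `Λ` by `e`, and which goes to `exit`
when it is done. -/
def code {Λ : Type} : (P : StackProg K) → (Lab P → Λ) → Λ → Lab P → MStmt K Λ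
  | skip, _, exit => fun _ => TM2.Stmt.goto fun _ => exit
  | push k s, _, exit => fun _ => TM2.Stmt.push (some k) (fun _ => s) (TM2.Stmt.goto fun _ => exit)
  | drop k, _, exit => fun _ => TM2.Stmt.pop (some k) (fun r _ => r) (TM2.Stmt.goto fun _ => exit)
  | copy a b, _, exit => fun _ => peekTop a
      (TM2.Stmt.push (some b) (fun r => r.getD Γ'.blank) (TM2.Stmt.goto fun _ => exit))
  | seq P Q, e, exit => Sum.elim (code P (fun l => e (Sum.inl l)) (e (Sum.inr (entry Q))))
      (code Q (fun l => e (Sum.inr l)) exit)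
  | ite k b P Q, e, exit => fun l => match l with
    | none => peekTop k (TM2.Stmt.branch b
        (TM2.Stmt.goto fun _ => e (some (Sum.inl (entry P))))
        (TM2.Stmt.goto fun _ => e (some (Sum.inr (entry Q)))))
    | some (Sum.inl l) => code P (fun l => e (some (Sum.inl l))) exit l
    | some (Sum.inr l) => code Q (fun l => e (some (Sum.inr l))) exit l
  | loop k b P, e, exit => fun l => match l with
    | none => peekTop k (TM2.Stmt.branch b
        (TM2.Stmt.goto fun _ => e (some (entry P))) (TM2.Stmt.goto fun _ => exit))
    | some l => code P (fun l => e (some l)) (e none) l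

/-- The stacks of the machine, with empty output stack. -/
def machineStacks (S : K → List Γ') : (k : Option K) → List (alphabet k)
  | none => ([] : List Bool)
  | some k => S k

theorem machineStacks_nil : (machineStacks fun _ : K => []) = fun _ => [] := by
  funext k
  cases k <;> rfl

variable [DecidableEq K]

theorem update_machineStacks (S : K → List Γ') (k : K) (l : List Γ') :
    update (machineStacks S) (some k) l = machineStacks (update S k l) := by
  funext j
  cases j with
  | none => rfl
  | some j =>
    by_cases h : j = k
    · subst h
      exact (update_self ..).trans (update_self (β := fun _ => List Γ') j l S).symm
    · have : (some j : Option K) ≠ some k := by simpa using h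
      exact (update_of_ne this ..).trans (update_of_ne (β := fun _ => List Γ') h l S).symm

/-- `n` steps of a machine lead from one configuration to another one. -/
def Steps {C : Type} (f : C → Option C) (n : ℕ) (c d : C) : Prop :=
  (flip bind f)^[n] (some c) = some d

theorem Steps.trans {C : Type} {f : C → Option C} {m n : ℕ} {a b c : C} (h : Steps f m a b)
    (h' : Steps f n b c) : Steps f (m + n) a c := by
  unfold Steps at *
  rw [add_comm, iterate_add_apply, h, h']

theorem Steps.one {C : Type} {f : C → Option C} {a b : C} (h : f a = some b) : Steps f 1 a b := h

/-- One `TM2` step executes a whole statement up to its `goto`, so the step counts agree exactly.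
The embedding `e` and the label `exit` are arbitrary so that the induction applies to subprograms
inside a larger program. The register may hold anything at the start, since every statement that
reads it peeks beforehand. -/
theorem Runs.steps {Λ : Type} {M : Λ → MStmt K Λ} {P : StackProg K} {S S' : K → List Γ'} {t : ℕ}
    (h : Runs P S S' t) : ∀ (e : Lab P → Λ) (exit : Λ) (_ : ∀ l, M (e l) = code P e exit l)
      (v : Option Γ'), ∃ v', Steps (TM2.step M) t ⟨some (e (entry P)), v, machineStacks S⟩
        ⟨some exit, v', machineStacks S'⟩ := by
  induction h with
  | skip S =>
    intro e exit hM v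
    refine ⟨v, Steps.one ?_⟩
    simp [hM, code]
  | push k s S =>
    intro e exit hM v
    refine ⟨v, Steps.one ?_⟩
    rw [← update_machineStacks]
    simp only [TM2.step, hM, code, TM2.stepAux]
    rfl
  | drop k S =>
    intro e exit hM v
    refine ⟨v, Steps.one ?_⟩
    rw [← update_machineStacks]
    simp only [TM2.step, hM, code, TM2.stepAux]
    rfl
  | copy a b S =>
    intro e exit hM v
    refine ⟨(S a).head?, Steps.one ?_⟩
    rw [← update_machineStacks]
    simp only [TM2.step, hM, code, TM2.stepAux, peekTop]
    rfl
  | @seq P Q S₁ S₂ S₃ t₁ t₂ _ _ ih₁ ih₂ =>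
    intro e exit hM v
    obtain ⟨v', h₁⟩ := ih₁ (fun l => e (Sum.inl l)) (e (Sum.inr (entry Q)))
      (fun l => hM (Sum.inl l)) v
    obtain ⟨v'', h₂⟩ := ih₂ (fun l => e (Sum.inr l)) exit (fun l => hM (Sum.inr l)) v'
    exact ⟨v'', h₁.trans h₂⟩
  | @ite_true k b P Q S S' t hb _ ih =>
    intro e exit hM v
    obtain ⟨v', h₁⟩ := ih (fun l => e (some (Sum.inl l))) exit
      (fun l => hM (some (Sum.inl l))) (S k).head?
    refine ⟨v', Steps.trans (Steps.one ?_) h₁⟩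
    have hb' : b (machineStacks S (some k)).head? = true := hb
    have hM' := hM none
    simp only [TM2.step, entry, hM', code, TM2.stepAux, peekTop, hb', cond_true]
    rfl
  | @ite_false k b P Q S S' t hb _ ih =>
    intro e exit hM v
    obtain ⟨v', h₁⟩ := ih (fun l => e (some (Sum.inr l))) exit
      (fun l => hM (some (Sum.inr l))) (S k).head?
    refine ⟨v', Steps.trans (Steps.one ?_) h₁⟩
    have hb' : b (machineStacks S (some k)).head? = false := hb
    have hM' := hM none
    simp only [TM2.step, entry, hM', code, TM2.stepAux, peekTop, hb', cond_false]
    rfl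
  | @loop_end k b P S hb =>
    intro e exit hM v
    refine ⟨(S k).head?, Steps.one ?_⟩
    have hb' : b (machineStacks S (some k)).head? = false := hb
    have hM' := hM none
    simp only [TM2.step, entry, hM', code, TM2.stepAux, peekTop, hb', cond_false]
    rfl
  | @loop_step k b P S₁ S₂ S₃ t₁ t₂ hb _ _ ih₁ ih₂ =>
    intro e exit hM v
    obtain ⟨v', h₁⟩ := ih₁ (fun l => e (some l)) (e none) (fun l => hM (some l)) (S₁ k).head?
    obtain ⟨v'', h₂⟩ := ih₂ e exit hM v'
    refine ⟨v'', Steps.trans (Steps.trans (Steps.one ?_) h₁) h₂⟩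
    have hb' : b (machineStacks S₁ (some k)).head? = true := hb
    have hM' := hM none
    simp only [TM2.step, entry, hM', code, TM2.stepAux, peekTop, hb', cond_true]
    rfl

/-- The last statement of the machine: move a bit to the output stack, and halt. -/
def outputStmt {Λ : Type} (out : K) : MStmt K Λ :=
  TM2.Stmt.pop (some out) (fun _ (o : Option Γ') => o)
    (TM2.Stmt.push none (fun r => (decide (r = some (Γ'.bit true)) : Bool))
      (TM2.Stmt.load (fun _ => none) TM2.Stmt.halt))

/-- The register ends at `none` because the halting configuration demanded by `haltList` contains
the initial state. -/
theorem step_outputStmt {Λ : Type} {M : Λ → MStmt K Λ} {l : Λ} {out : K} (hM : M l = outputStmt out)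
    (v : Option Γ') (b : Bool) :
    TM2.step M ⟨some l, v, machineStacks (update (fun _ => []) out [Γ'.bit b])⟩ =
      some ⟨none, none, update (machineStacks fun _ => []) none ([b] : List Bool)⟩ := by
  have h : machineStacks (update (fun _ => []) out [Γ'.bit b]) (some out) = [Γ'.bit b] :=
    update_self (β := fun _ => List Γ') out [Γ'.bit b] fun _ => []
  have h' : update (machineStacks (update (fun _ => []) out [Γ'.bit b])) (some out) ([] : List Γ') =
      machineStacks (K := K) fun _ => [] := by
    rw [update_machineStacks, update_idem]
    congr 1
    exact update_eq_self (β := fun _ => List Γ') out fun _ => []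
  refine congrArg some ?_
  rw [hM]
  -- Abstracting the stacks and the popped list lets the step compute by `rfl`; rewriting inside the
  -- dependent family of stacks is avoided.
  have key : ∀ (S : (k : Option K) → List (alphabet k)) (s : List Γ'), S (some out) = s →
      TM2.stepAux (outputStmt (Λ := Λ) out) v S = ⟨none, none, update
        (update S (some out) s.tail) none
          ((decide (s.head? = some (Γ'.bit true)) ::
            update S (some out) s.tail none : List Bool))⟩ := by
    rintro S s rfl
    rfl
  refine (key _ _ h).trans ?_
  simp only [List.tail_cons, h', List.head?_cons]
  cases b <;> rfl

/-- The machine that runs `P` with its input on the stack `inp`, and outputs the bit on the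
stack `out`. -/
def machine [Fintype K] (P : StackProg K) (inp out : K) : FinTM2 where
  K := Option K
  k₀ := some inp
  k₁ := none
  Γ := alphabet
  Λ := Option (Lab P)
  main := some (entry P)
  σ := Option Γ'
  initialState := none
  Γk₀Fin := inferInstanceAs (Fintype Γ')
  m l := match l with
    | none => outputStmt out
    | some l => code P some none l

theorem initList_eq (tm : FinTM2) (s : List (tm.Γ tm.k₀)) :
    initList tm s = ⟨some tm.main, tm.initialState, update (fun _ => []) tm.k₀ s⟩ := by
  unfold initList
  congr 1
  funext k
  by_cases h : k = tm.k₀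
  · subst h
    simp
  · simp [h]

theorem haltList_eq (tm : FinTM2) (s : List (tm.Γ tm.k₁)) :
    haltList tm s = ⟨none, tm.initialState, update (fun _ => []) tm.k₁ s⟩ := by
  unfold haltList
  congr 1
  funext k
  by_cases h : k = tm.k₁
  · subst h
    simp
  · simp [h]

/-- A program that leaves nothing but the bit `f a` on the stack `out`, within polynomial time,
shows that `f` is computable in polynomial time. -/
theorem nonempty_polyTime [Fintype K] {α : Type} (ea : α → List Γ') (f : α → Bool)
    (P : StackProg K) (inp out : K) (T : Polynomial ℕ)
    (h : ∀ a, ∃ t ≤ T.eval (ea a).length,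
      Runs P (update (fun _ => []) inp (ea a)) (update (fun _ => []) out [Γ'.bit (f a)]) t) :
    Nonempty (TM2ComputableInPolyTime ea encodingBoolBool.encode f) := by
  choose t ht hr using h
  -- The additional step is the final output statement.
  refine ⟨⟨⟨machine P inp out, Equiv.refl Γ', Equiv.refl Bool⟩, T + 1, fun a =>
    ⟨⟨t a + 1, ?_⟩, ?_⟩⟩⟩
  · obtain ⟨v, hv⟩ := (hr a).steps (M := (machine P inp out).m) (Λ := Option (Lab P))
      some none (fun l => rfl) none
    have h₁ : initList (machine P inp out) ((ea a).map (Equiv.refl Γ').invFun) =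
        ⟨some (some (entry P)), none, machineStacks (update (fun _ => []) inp (ea a))⟩ := by
      rw [← update_machineStacks, machineStacks_nil]
      exact (congrArg (initList (machine P inp out)) (List.map_id (ea a))).trans
        (initList_eq (machine P inp out) (ea a))
    have h₂ : haltList (machine P inp out)
        ((encodingBoolBool.encode (f a)).map (Equiv.refl Bool).invFun) =
        ⟨none, none, update (machineStacks fun _ => []) none ([f a] : List Bool)⟩ := by
      rw [machineStacks_nil]
      exact haltList_eq (machine P inp out) _
    refine Eq.trans ?_ (congrArg some h₂.symm)
    refine Eq.trans (congrArg _ (congrArg some h₁)) ?_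
    exact Steps.trans hv (Steps.one (step_outputStmt (M := (machine P inp out).m) (l := none) (out := out)
      rfl v (f a)))
  · simpa using ht a

end StackProg

/-! ### Time-bounded execution and elementary programs that move, copy and clear. -/

namespace StackProg

variable {K : Type} [DecidableEq K]

/-- `Exec P S S' T`: started on the stacks `S`, the program `P` ends with `S'` within `T` steps. -/
def Exec (P : StackProg K) (S S' : K → List Γ') (T : ℕ) : Prop := ∃ t ≤ T, Runs P S S' t

theorem Exec.mono {P : StackProg K} {S S' : K → List Γ'} {T T' : ℕ} (h : Exec P S S' T)
    (hT : T ≤ T') : Exec P S S' T' :=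
  let ⟨t, ht, hr⟩ := h
  ⟨t, ht.trans hT, hr⟩

theorem Exec.to {P : StackProg K} {S S' S'' : K → List Γ'} {T T' : ℕ} (h : Exec P S S' T)
    (hS : S' = S'') (hT : T ≤ T') : Exec P S S'' T' := hS ▸ h.mono hT

theorem Exec.seq {P Q : StackProg K} {S₁ S₂ S₃ : K → List Γ'} {T₁ T₂ : ℕ} (h₁ : Exec P S₁ S₂ T₁)
    (h₂ : Exec Q S₂ S₃ T₂) : Exec (P ⨟ Q) S₁ S₃ (T₁ + T₂) :=
  let ⟨_, ht₁, hr₁⟩ := h₁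
  let ⟨_, ht₂, hr₂⟩ := h₂
  ⟨_, add_le_add ht₁ ht₂, hr₁.seq hr₂⟩

theorem Exec.skip (S : K → List Γ') : Exec skip S S 1 := ⟨1, le_rfl, Runs.skip S⟩

theorem Exec.push (k : K) (s : Γ') (S : K → List Γ') :
    Exec (push k s) S (update S k (s :: S k)) 1 := ⟨1, le_rfl, Runs.push k s S⟩

theorem Exec.drop (k : K) (S : K → List Γ') :
    Exec (drop k) S (update S k (S k).tail) 1 := ⟨1, le_rfl, Runs.drop k S⟩

theorem Exec.copy {a : K} {S : K → List Γ'} {s : Γ'} {l : List Γ'} (b : K) (h : S a = s :: l) :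
    Exec (copy a b) S (update S b (s :: S b)) 1 := by
  have := Runs.copy a b S
  rw [h] at this
  exact ⟨1, le_rfl, this⟩

theorem Exec.ite_true {k : K} {b : Option Γ' → Bool} {P Q : StackProg K} {S S' : K → List Γ'}
    {T : ℕ} (hb : b (S k).head? = true) (h : Exec P S S' T) : Exec (ite k b P Q) S S' (1 + T) :=
  let ⟨_, ht, hr⟩ := h
  ⟨_, add_le_add le_rfl ht, hr.ite_true hb⟩

theorem Exec.ite_false {k : K} {b : Option Γ' → Bool} {P Q : StackProg K} {S S' : K → List Γ'}
    {T : ℕ} (hb : b (S k).head? = false) (h : Exec Q S S' T) : Exec (ite k b P Q) S S' (1 + T) :=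
  let ⟨_, ht, hr⟩ := h
  ⟨_, add_le_add le_rfl ht, hr.ite_false hb⟩

theorem Exec.loop_end {k : K} {b : Option Γ' → Bool} {P : StackProg K} {S : K → List Γ'}
    (hb : b (S k).head? = false) : Exec (loop k b P) S S 1 :=
  ⟨1, le_rfl, Runs.loop_end hb⟩

theorem Exec.loop_step {k : K} {b : Option Γ' → Bool} {P : StackProg K} {S₁ S₂ S₃ : K → List Γ'}
    {T₁ T₂ : ℕ} (hb : b (S₁ k).head? = true) (h₁ : Exec P S₁ S₂ T₁)
    (h₂ : Exec (loop k b P) S₂ S₃ T₂) : Exec (loop k b P) S₁ S₃ (1 + T₁ + T₂) :=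
  let ⟨_, ht₁, hr₁⟩ := h₁
  let ⟨_, ht₂, hr₂⟩ := h₂
  ⟨_, by omega, Runs.loop_step hb hr₁ hr₂⟩

/-- A loop that passes through the states `f 0`, ..., `f m`. -/
theorem Exec.loop {k : K} {b : Option Γ' → Bool} {P : StackProg K} {T : ℕ} (m : ℕ)
    (f : ℕ → K → List Γ') (hb : ∀ i < m, b (f i k).head? = true) (hm : b (f m k).head? = false)
    (h : ∀ i < m, Exec P (f i) (f (i + 1)) T) :
    Exec (loop k b P) (f 0) (f m) (m * (T + 1) + 1) := by
  induction m generalizing f with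
  | zero => exact (Exec.loop_end hm).mono (by omega)
  | succ m ih =>
    refine (Exec.loop_step (hb 0 (by omega)) (h 0 (by omega))
      (ih (fun i => f (i + 1)) (fun i hi => hb _ (by omega)) hm fun i hi => h _ (by omega))).mono ?_
    rw [Nat.succ_mul]
    omega

/-- Move the top of `a` to `b`. -/
def mv (a b : K) : StackProg K := copy a b ⨟ drop a

theorem Exec.mv {a b : K} (hab : a ≠ b) {S : K → List Γ'} {s : Γ'} {l : List Γ'}
    (h : S a = s :: l) : Exec (mv a b) S (update (update S a l) b (s :: S b)) 2 := by
  have h₂ := Exec.drop a (update S b (s :: S b))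
  rw [update_of_ne hab, h, List.tail_cons, update_comm hab.symm] at h₂
  exact (Exec.copy b h).seq h₂

/-- Move symbols from `a` to `b` as long as they satisfy `p`. -/
def moveWhile (p : Γ' → Bool) (a b : K) : StackProg K := loop a (fun o => o.any p) (mv a b)

/-- The last hypothesis makes the loop stop exactly at `l₂`, also when `l₂` is empty. Passing from
stack to stack reverses the word. -/
theorem Exec.moveWhile {p : Γ' → Bool} {a b : K} (hab : a ≠ b) {S : K → List Γ'}
    {l₁ l₂ : List Γ'} (h : S a = l₁ ++ l₂) (h₁ : ∀ s ∈ l₁, p s = true)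
    (h₂ : l₂.head?.any p = false) :
    Exec (moveWhile p a b) S (update (update S a l₂) b (l₁.reverse ++ S b))
      (3 * l₁.length + 1) := by
  induction l₁ generalizing S with
  | nil =>
    have : update (update S a l₂) b ([].reverse ++ S b) = S := by
      rw [List.nil_append] at h
      rw [← h]
      simp
    rw [this]
    exact (Exec.loop_end (by simpa [h] using h₂)).mono (by simp)
  | cons s l₁ ih =>
    have := ih (S := update (update S a (l₁ ++ l₂)) b (s :: S b)) (by simp [hab])
      fun x hx => h₁ x (by simp [hx])
    refine (Exec.loop_step (by simp [h, h₁]) (Exec.mv hab h) this).to ?_ (by simp; omega)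
    funext k
    by_cases hb : k = b
    · subst hb
      simp
    · by_cases ha : k = a
      · subst ha
        simp [hb]
      · simp [ha, hb]

/-- Move everything from `a` to `b`. -/
def moveAll (a b : K) : StackProg K := moveWhile (fun _ => true) a b

theorem Exec.moveAll {a b : K} (hab : a ≠ b) (S : K → List Γ') :
    Exec (moveAll a b) S (update (update S a []) b ((S a).reverse ++ S b))
      (3 * (S a).length + 1) :=
  Exec.moveWhile hab (by simp) (by simp) (by simp)

/-- Move symbols from `a` to both `b` and `c` as long as they satisfy `p`. -/
def copyWhile (p : Γ' → Bool) (a b c : K) : StackProg K :=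
  loop a (fun o => o.any p) (copy a c ⨟ mv a b)

theorem Exec.copyWhile {p : Γ' → Bool} {a b c : K} (hab : a ≠ b) (hac : a ≠ c) (hbc : b ≠ c)
    {S : K → List Γ'} {l₁ l₂ : List Γ'} (h : S a = l₁ ++ l₂) (h₁ : ∀ s ∈ l₁, p s = true)
    (h₂ : l₂.head?.any p = false) :
    Exec (copyWhile p a b c) S
      (update (update (update S a l₂) b (l₁.reverse ++ S b)) c (l₁.reverse ++ S c))
      (4 * l₁.length + 1) := by
  induction l₁ generalizing S with
  | nil =>
    refine (Exec.loop_end (by simpa [h] using h₂)).to ?_ (by simp)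
    rw [List.nil_append] at h
    rw [← h]
    simp
  | cons s l₁ ih =>
    have step : Exec (StackProg.copy a c ⨟ StackProg.mv a b) S (update (update (update S a (l₁ ++ l₂)) b
        (s :: S b)) c (s :: S c)) 3 := by
      refine ((Exec.copy c h).seq (Exec.mv hab (s := s) (l := l₁ ++ l₂) ?_)).to ?_ le_rfl
      · rw [update_of_ne hac, h, List.cons_append]
      · rw [update_of_ne hbc, update_comm hac.symm, update_comm hbc.symm]
    have := ih (S := update (update (update S a (l₁ ++ l₂)) b (s :: S b)) c (s :: S c))
      (by simp [hab, hac]) fun x hx => h₁ x (by simp [hx])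
    refine (Exec.loop_step (by simp [h, h₁]) step this).to ?_ (by simp; omega)
    funext k
    by_cases hc : k = c
    · subst hc
      simp
    · by_cases hb : k = b
      · subst hb
        simp [hc]
      · by_cases ha : k = a
        · subst ha
          simp [hb, hc]
        · simp [ha, hb, hc]

/-- Empty the stack `a`. -/
def clear (a : K) : StackProg K := loop a (fun o => o.isSome) (drop a)

theorem Exec.clear (a : K) (S : K → List Γ') :
    Exec (clear a) S (update S a []) (2 * (S a).length + 1) := by
  obtain ⟨l, hl⟩ : ∃ l, S a = l := ⟨_, rfl⟩
  rw [hl]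
  induction l generalizing S with
  | nil =>
    refine (Exec.loop_end (by simp [hl])).to ?_ (by simp)
    rw [← hl, update_eq_self]
  | cons s l ih =>
    refine (Exec.loop_step (by simp [hl]) (Exec.drop a S) (ih _ (by simp [hl]))).to ?_
      (by simp; omega)
    simp

end StackProg

/-! ### Memory layout and navigation in the input. -/

namespace MHVMachine

open StackProg

/-- The stacks of the machine. The variable `x` ranges over the vertices, its value is kept in
unary on `val x`, and `rest x` holds the remaining ticks. -/
inductive Stk : Type
  | inp | done | aux | c | d | res | ell | kk
  | val (x : Fin 8)
  | rest (x : Fin 8)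
  deriving DecidableEq, Fintype

/-- The contents of the stacks. -/
structure Mem : Type where
  inp : List Γ'
  done : List Γ'
  aux : List Γ'
  c : List Γ'
  d : List Γ'
  res : List Γ'
  ell : List Γ'
  kk : List Γ'
  val : Fin 8 → List Γ'
  rest : Fin 8 → List Γ'

/-- The contents of a stack. -/
def Mem.stk (m : Mem) : Stk → List Γ'
  | .inp => m.inp
  | .done => m.done
  | .aux => m.aux
  | .c => m.c
  | .d => m.d
  | .res => m.res
  | .ell => m.ell
  | .kk => m.kk
  | .val x => m.val x
  | .rest x => m.rest x

section
variable (m : Mem) (l : List Γ') (x : Fin 8)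

@[simp] theorem stk_inp : m.stk .inp = m.inp := rfl
@[simp] theorem stk_done : m.stk .done = m.done := rfl
@[simp] theorem stk_aux : m.stk .aux = m.aux := rfl
@[simp] theorem stk_c : m.stk .c = m.c := rfl
@[simp] theorem stk_d : m.stk .d = m.d := rfl
@[simp] theorem stk_res : m.stk .res = m.res := rfl
@[simp] theorem stk_ell : m.stk .ell = m.ell := rfl
@[simp] theorem stk_kk : m.stk .kk = m.kk := rfl
@[simp] theorem stk_val : m.stk (.val x) = m.val x := rfl
@[simp] theorem stk_rest : m.stk (.rest x) = m.rest x := rfl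

@[simp] theorem update_inp : update m.stk .inp l = ({m with inp := l} : Mem).stk := by
  funext k; cases k <;> simp [Mem.stk]
@[simp] theorem update_done : update m.stk .done l = ({m with done := l} : Mem).stk := by
  funext k; cases k <;> simp [Mem.stk]
@[simp] theorem update_aux : update m.stk .aux l = ({m with aux := l} : Mem).stk := by
  funext k; cases k <;> simp [Mem.stk]
@[simp] theorem update_c : update m.stk .c l = ({m with c := l} : Mem).stk := by
  funext k; cases k <;> simp [Mem.stk]
@[simp] theorem update_d : update m.stk .d l = ({m with d := l} : Mem).stk := by
  funext k; cases k <;> simp [Mem.stk]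
@[simp] theorem update_res : update m.stk .res l = ({m with res := l} : Mem).stk := by
  funext k; cases k <;> simp [Mem.stk]
@[simp] theorem update_ell : update m.stk .ell l = ({m with ell := l} : Mem).stk := by
  funext k; cases k <;> simp [Mem.stk]
@[simp] theorem update_kk : update m.stk .kk l = ({m with kk := l} : Mem).stk := by
  funext k; cases k <;> simp [Mem.stk]
@[simp] theorem update_val :
    update m.stk (.val x) l = ({m with val := update m.val x l} : Mem).stk := by
  funext k; cases k <;> simp [Mem.stk, update_apply]
@[simp] theorem update_rest :
    update m.stk (.rest x) l = ({m with rest := update m.rest x l} : Mem).stk := by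
  funext k; cases k <;> simp [Mem.stk, update_apply]

end

/-- `n` in unary. -/
abbrev ticks (n : ℕ) : List Γ' := List.replicate n Γ'.blank

theorem ticks_succ (n : ℕ) : ticks (n + 1) = Γ'.blank :: ticks n := List.replicate_succ

theorem head?_ticks_isSome {n : ℕ} : (ticks n).head?.isSome = decide (0 < n) := by
  cases n <;> simp [ticks_succ]

/-! ### The vertex entries of the input -/

variable (I : MHVInstance)

/-- The entries of the vertices from `i` on. -/
noncomputable def entriesFrom (i : ℕ) : List Γ' :=
  ((List.finRange I.n).drop i).flatMap I.encodeVertex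

/-- The entries of the vertices before `i`. -/
noncomputable def entriesBefore (i : ℕ) : List Γ' :=
  ((List.finRange I.n).take i).flatMap I.encodeVertex

/-- The stacks `done` (reversed) and `inp` play the two sides of a tape head; this identity allows
`rewind` to restore the input. -/
theorem entriesBefore_append (i : ℕ) : entriesBefore I i ++ entriesFrom I i = entriesFrom I 0 := by
  rw [entriesBefore, entriesFrom, ← List.flatMap_append, List.take_append_drop]
  rfl

theorem entriesBefore_zero : entriesBefore I 0 = [] := rfl

theorem entriesFrom_eq {i : ℕ} (hi : i < I.n) :
    entriesFrom I i = I.encodeVertex ⟨i, hi⟩ ++ entriesFrom I (i + 1) := by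
  rw [entriesFrom, List.drop_eq_getElem_cons (by simpa using hi)]
  simp [entriesFrom]

theorem entriesBefore_succ {i : ℕ} (hi : i < I.n) :
    entriesBefore I (i + 1) = entriesBefore I i ++ I.encodeVertex ⟨i, hi⟩ := by
  rw [entriesBefore, List.take_succ_eq_append_getElem (by simpa using hi)]
  simp [entriesBefore]

open Classical in
/-- A row of the adjacency matrix. -/
noncomputable def row (v : Fin I.n) : List Γ' :=
  (List.finRange I.n).map fun u => Γ'.bit (decide (I.graph.Adj v u))

theorem encodeVertex_eq (v : Fin I.n) : I.encodeVertex v =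
    Γ'.bra :: (MHVInstance.encodeColor (I.p v) ++ Γ'.comma :: (row I v ++ [Γ'.ket])) := by
  simp [MHVInstance.encodeVertex, row]

/-- Ensures that scanning for a delimiter does not stop inside a precolor. -/
theorem mem_encodeColor {ℓ : ℕ} {o : Option (Fin ℓ)} {s : Γ'} (h : s ∈ MHVInstance.encodeColor o) :
    s ≠ Γ'.ket ∧ s ≠ Γ'.comma := by
  cases o with
  | none => simp_all [MHVInstance.encodeColor]
  | some a =>
    simp only [MHVInstance.encodeColor, List.mem_map] at h
    obtain ⟨b, -, rfl⟩ := h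
    simp

theorem mem_row {v : Fin I.n} {s : Γ'} (h : s ∈ row I v) : ∃ b, s = Γ'.bit b := by
  simp only [row, List.mem_map] at h
  obtain ⟨b, -, rfl⟩ := h
  exact ⟨_, rfl⟩

/-- The number of symbols of the vertex entries. -/
noncomputable def bodyLength : ℕ := (entriesFrom I 0).length

theorem length_encodeVertex_le (v : Fin I.n) : (I.encodeVertex v).length ≤ bodyLength I := by
  rw [bodyLength, ← entriesBefore_append I v, entriesFrom_eq I v.2]
  simp
  omega

theorem length_entriesBefore_le (i : ℕ) : (entriesBefore I i).length ≤ bodyLength I := by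
  rw [bodyLength, ← entriesBefore_append I i]
  simp

/-- Every entry is nonempty. The resulting bound of `I.n` by the input length is what makes unary
counters and loops over vertices affordable. -/
theorem le_length_entriesBefore {i : ℕ} (hi : i ≤ I.n) : i ≤ (entriesBefore I i).length := by
  induction i with
  | zero => simp
  | succ i ih =>
    rw [entriesBefore_succ I hi, encodeVertex_eq]
    have := ih (by omega)
    simp
    omega

theorem n_le_bodyLength : I.n ≤ bodyLength I :=
  (le_length_entriesBefore I le_rfl).trans (length_entriesBefore_le I _)

/-- Skip the entry of a vertex. -/
def skipEntry : StackProg Stk :=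
  moveWhile (fun s => decide (s ≠ Γ'.ket)) .inp .done ⨟ mv .inp .done

theorem exec_skipEntry {m : Mem} {i : ℕ} (hi : i < I.n) (h : m.inp = entriesFrom I i)
    (h' : m.done = (entriesBefore I i).reverse) :
    Exec skipEntry m.stk ({m with
      inp := entriesFrom I (i + 1), done := (entriesBefore I (i + 1)).reverse} : Mem).stk
      (3 * bodyLength I + 3) := by
  obtain ⟨l, hl, hk⟩ : ∃ l, I.encodeVertex ⟨i, hi⟩ = l ++ [Γ'.ket] ∧ ∀ s ∈ l, s ≠ Γ'.ket := by
    refine ⟨Γ'.bra :: (MHVInstance.encodeColor (I.p ⟨i, hi⟩) ++ Γ'.comma :: row I ⟨i, hi⟩),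
      by simp [encodeVertex_eq], ?_⟩
    simp only [List.mem_cons, List.mem_append]
    rintro s (rfl | hs | rfl | hs)
    · simp
    · exact (mem_encodeColor hs).1
    · simp
    · obtain ⟨b, rfl⟩ := mem_row I hs
      simp
  have hlen := length_encodeVertex_le I ⟨i, hi⟩
  have h₁ := Exec.moveWhile (p := fun s => decide (s ≠ Γ'.ket)) (a := Stk.inp) (b := Stk.done)
    (by decide) (S := m.stk) (l₁ := l) (l₂ := Γ'.ket :: entriesFrom I (i + 1))
    (by rw [stk_inp, h, entriesFrom_eq I hi, hl]; simp) (by simpa using hk) (by simp)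
  simp only [update_inp, update_done] at h₁
  refine (h₁.seq (Exec.mv (by decide) rfl)).to ?_ ?_
  · simp [h', entriesBefore_succ I hi, hl]
  · rw [hl] at hlen
    simp at hlen
    omega

/-- Run a program as often as the variable `x` says. -/
def repeatVar (x : Fin 8) (P : StackProg Stk) : StackProg Stk :=
  loop (.val x) (fun o => o.isSome) (mv (.val x) .aux ⨟ P) ⨟ moveAll .aux (.val x)

/-- Move to the entry of the vertex `x`. -/
def gotoEntry (x : Fin 8) : StackProg Stk := repeatVar x skipEntry

/-- The functions `f` and `g` trace the two sides of the head. The body is assumed correct on every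
memory with these two stacks, since `val x` and `aux` change during the loop: the ticks wait on
`aux` and are put back at the end. -/
theorem exec_repeatVar {P : StackProg Stk} {x : Fin 8} {m : Mem} {s T : ℕ} (f g : ℕ → List Γ')
    (hs : m.val x = ticks s) (ha : m.aux = [])
    (h : ∀ j < s, ∀ m : Mem, m.inp = f j → m.done = g j →
      Exec P m.stk ({m with inp := f (j + 1), done := g (j + 1)} : Mem).stk T)
    (hf : m.inp = f 0) (hg : m.done = g 0) :
    Exec (repeatVar x P) m.stk ({m with inp := f s, done := g s} : Mem).stk
      (s * (T + 6) + 2) := by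
  have h₁ := Exec.loop (P := mv (.val x) .aux ⨟ P) (k := Stk.val x) (b := fun o => o.isSome)
    (T := 2 + T) s (fun j => ({m with
      inp := f j
      done := g j
      val := update m.val x (ticks (s - j))
      aux := ticks j } : Mem).stk) (fun j hj => by simp [head?_ticks_isSome, hj]) (by simp)
      (fun j hj => by
        have hj' : s - j = (s - (j + 1)) + 1 := by omega
        refine (Exec.mv (s := Γ'.blank) (l := ticks (s - (j + 1))) (by simp) ?_).seq ?_
        · simp only [stk_val, update_self]
          rw [hj', ticks_succ]
        · refine (h j hj ({m with
            inp := f j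
            done := g j
            val := update m.val x (ticks (s - (j + 1)))
            aux := ticks (j + 1) } : Mem) rfl rfl).to rfl le_rfl |> fun e => ?_
          simpa [ticks_succ] using e)
  have h₂ := Exec.moveAll (a := Stk.aux) (b := Stk.val x) (by simp) ({m with
      inp := f s
      done := g s
      val := update m.val x (ticks (s - s))
      aux := ticks s } : Mem).stk
  have h₀ : m.stk = ({m with
      inp := f 0
      done := g 0
      val := update m.val x (ticks (s - 0))
      aux := ticks 0 } : Mem).stk := by
    rw [← hf, ← hg, Nat.sub_zero, ← hs, update_eq_self]
    simp [← ha]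
  rw [h₀]
  refine (h₁.seq h₂).to ?_ ?_
  · have hu : update m.val x (ticks s) = m.val := by rw [← hs, update_eq_self]
    simp [ha, hu]
  · simp
    ring_nf
    omega

theorem exec_gotoEntry {m : Mem} {x : Fin 8} {s : ℕ} (hs : m.val x = ticks s) (hsn : s ≤ I.n)
    (ha : m.aux = []) (hi : m.inp = entriesFrom I 0) (hd : m.done = []) :
    Exec (gotoEntry x) m.stk
      ({m with inp := entriesFrom I s, done := (entriesBefore I s).reverse} : Mem).stk
      (s * (3 * bodyLength I + 9) + 2) :=
  exec_repeatVar (entriesFrom I) (fun j => (entriesBefore I j).reverse) hs ha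
    (fun _ hj _ h h' => exec_skipEntry I (by omega) h h') hi
    (by simp [hd, entriesBefore_zero])

/-- Return to the beginning of the vertex entries. -/
def rewind : StackProg Stk := moveAll .done .inp

theorem exec_rewind {m : Mem} (h : m.done.reverse ++ m.inp = entriesFrom I 0) :
    Exec rewind m.stk ({m with inp := entriesFrom I 0, done := []} : Mem).stk
      (3 * bodyLength I + 1) := by
  refine (Exec.moveAll (by decide) _).to ?_ ?_
  · simp [h]
  · have := congrArg List.length h
    simp at this ⊢
    rw [bodyLength]
    omega

end MHVMachine

/-! ### Evaluating adjacency and compatibility of precolors. -/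

namespace MHVMachine

open StackProg

variable (I : MHVInstance)

/-- Push the entry of the adjacency matrix at the variables `i` and `j`. -/
def adjProg (i j : Fin 8) : StackProg Stk :=
  gotoEntry i ⨟ moveWhile (fun s => decide (s ≠ Γ'.comma)) .inp .done ⨟ mv .inp .done ⨟
    repeatVar j (mv .inp .done) ⨟ copy .inp .res ⨟ rewind

theorem entry_prefix {s : Γ'} {v : Fin I.n}
    (h : s ∈ Γ'.bra :: MHVInstance.encodeColor (I.p v)) : s ≠ Γ'.comma := by
  rcases List.mem_cons.1 h with rfl | h
  · simp
  · exact (mem_encodeColor h).2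

open Classical in
theorem exec_adjProg {m : Mem} {i j : Fin 8} (a b : Fin I.n) (hi : m.val i = ticks a)
    (hj : m.val j = ticks b) (ha : m.aux = []) (hinp : m.inp = entriesFrom I 0)
    (hd : m.done = []) :
    Exec (adjProg i j) m.stk
      ({m with res := Γ'.bit (decide (I.graph.Adj a b)) :: m.res} : Mem).stk
      (30 * (bodyLength I + 1) ^ 2) := by
  set pre := Γ'.bra :: MHVInstance.encodeColor (I.p a) with hpre
  have hentry : entriesFrom I a = pre ++ (Γ'.comma :: (row I a ++ Γ'.ket :: entriesFrom I (a + 1))) := by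
    rw [entriesFrom_eq I a.2, encodeVertex_eq]
    simp [hpre]
  have hrow : (row I a).length = I.n := by simp [row]
  have h₁ := exec_gotoEntry I hi a.2.le ha hinp hd
  have h₂ := Exec.moveWhile (p := fun s => decide (s ≠ Γ'.comma)) (a := Stk.inp) (b := Stk.done)
    (by decide) (S := ({m with
      inp := entriesFrom I a, done := (entriesBefore I a).reverse} : Mem).stk)
    (l₁ := pre) (l₂ := Γ'.comma :: (row I a ++ Γ'.ket :: entriesFrom I (a + 1)))
    (by rw [stk_inp, hentry]) (fun s hs => by simpa using entry_prefix I hs) (by simp)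
  simp only [update_inp, update_done, stk_done] at h₂
  have h₃ := Exec.mv (a := Stk.inp) (b := Stk.done) (by decide) (S := ({m with
      inp := Γ'.comma :: (row I a ++ Γ'.ket :: entriesFrom I (a + 1))
      done := pre.reverse ++ (entriesBefore I a).reverse} : Mem).stk) rfl
  simp only [update_inp, update_done, stk_done] at h₃
  -- Invariant: after `k` moves the head stands before column `k` of the row, so after `b` moves the
  -- wanted entry is on top of `inp`.
  have h₄ := exec_repeatVar (P := mv .inp .done) (x := j) (m := {m with
      inp := row I a ++ Γ'.ket :: entriesFrom I (a + 1)
      done := Γ'.comma :: (pre.reverse ++ (entriesBefore I a).reverse)}) (s := b) (T := 2)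
    (fun k => (row I a).drop k ++ Γ'.ket :: entriesFrom I (a + 1))
    (fun k => ((row I a).take k).reverse ++ Γ'.comma :: (pre.reverse ++
      (entriesBefore I a).reverse)) hj ha (fun k hk m' h h' => by
        have hk' : k < (row I a).length := by omega
        refine (Exec.mv (s := (row I a)[k])
          (l := (row I a).drop (k + 1) ++ Γ'.ket :: entriesFrom I (a + 1)) (by decide) ?_).to ?_ le_rfl
        · rw [stk_inp, h, List.drop_eq_getElem_cons hk']
          rfl
        · have ht : ((row I a).take (k + 1)).reverse =
              (row I a)[k] :: ((row I a).take k).reverse := by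
            rw [List.take_succ_eq_append_getElem hk', List.reverse_append]
            rfl
          simp only [update_inp, update_done, stk_done, h', ht, List.cons_append]) rfl rfl
  have hb : (b : ℕ) < (row I a).length := by omega
  have h₅ := Exec.copy (a := Stk.inp) Stk.res (S := ({m with
      inp := (row I a).drop b ++ Γ'.ket :: entriesFrom I (a + 1)
      done := ((row I a).take b).reverse ++ Γ'.comma :: (pre.reverse ++
        (entriesBefore I a).reverse)} : Mem).stk) (by
      rw [stk_inp, List.drop_eq_getElem_cons hb, List.cons_append])
  simp only [update_res, stk_res] at h₅
  have hbit : (row I a)[(b : ℕ)] = Γ'.bit (decide (I.graph.Adj a b)) := by simp [row]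
  rw [hbit] at h₅
  have h₆ := exec_rewind I (m := {m with
      inp := (row I a).drop b ++ Γ'.ket :: entriesFrom I (a + 1)
      done := ((row I a).take b).reverse ++ Γ'.comma :: (pre.reverse ++
        (entriesBefore I a).reverse)
      res := Γ'.bit (decide (I.graph.Adj a b)) :: m.res}) (by
    rw [← entriesBefore_append I a, hentry]
    simp [← List.append_assoc (List.take _ _)])
  refine (h₁.seq (h₂.seq (h₃.seq (h₄.seq (h₅.seq h₆))))).to ?_ ?_
  · simp [← hd, ← hinp]
  · have hn := n_le_bodyLength I
    have hp : pre.length ≤ bodyLength I := by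
      have := length_encodeVertex_le I a
      rw [encodeVertex_eq] at this
      simp [hpre] at this ⊢
      omega
    have : (a : ℕ) * (3 * bodyLength I + 9) ≤ bodyLength I * (3 * bodyLength I + 9) :=
      Nat.mul_le_mul_right _ (by omega)
    nlinarith

/-- Put the precolor of the variable `x` on the stack `t`, in reverse. -/
def colorProg (x : Fin 8) (t : Stk) : StackProg Stk :=
  gotoEntry x ⨟ mv .inp .done ⨟ copyWhile (fun s => decide (s ≠ Γ'.comma)) .inp .done t ⨟ rewind

/-- The target stack `t` is a parameter, so the resulting memory `m'` is described by an equation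
instead of a record update. -/
theorem exec_colorProg {m m' : Mem} {x : Fin 8} {t : Stk} (a : Fin I.n) (hx : m.val x = ticks a)
    (ha : m.aux = []) (hinp : m.inp = entriesFrom I 0) (hd : m.done = [])
    (ht : t ≠ .inp ∧ t ≠ .done)
    (hm' : update m.stk t ((MHVInstance.encodeColor (I.p a)).reverse ++ m.stk t) = m'.stk) :
    Exec (colorProg x t) m.stk m'.stk (30 * (bodyLength I + 1) ^ 2) := by
  set col := MHVInstance.encodeColor (I.p a) with hcol
  have hentry : entriesFrom I a =
      Γ'.bra :: (col ++ (Γ'.comma :: (row I a ++ Γ'.ket :: entriesFrom I (a + 1)))) := by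
    rw [entriesFrom_eq I a.2, encodeVertex_eq]
    simp [hcol]
  have h₁ := exec_gotoEntry I hx a.2.le ha hinp hd
  have h₂ := Exec.mv (a := Stk.inp) (b := Stk.done) (by decide) (S := ({m with
    inp := entriesFrom I a, done := (entriesBefore I a).reverse} : Mem).stk)
    (s := Γ'.bra) (by rw [stk_inp, hentry])
  simp only [update_inp, update_done, stk_done] at h₂
  have h₃ := Exec.copyWhile (p := fun s => decide (s ≠ Γ'.comma)) (a := Stk.inp) (b := Stk.done)
    (c := t) (by decide) ht.1.symm ht.2.symm (S := ({m with
      inp := col ++ (Γ'.comma :: (row I a ++ Γ'.ket :: entriesFrom I (a + 1)))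
      done := Γ'.bra :: (entriesBefore I a).reverse} : Mem).stk) (l₁ := col) rfl
    (fun s hs => by simpa using (mem_encodeColor hs).2) (by simp)
  have e : update (update (update ({m with
      inp := col ++ (Γ'.comma :: (row I a ++ Γ'.ket :: entriesFrom I (a + 1)))
      done := Γ'.bra :: (entriesBefore I a).reverse} : Mem).stk .inp
        (Γ'.comma :: (row I a ++ Γ'.ket :: entriesFrom I (a + 1)))) .done
        (col.reverse ++ Γ'.bra :: (entriesBefore I a).reverse)) t (col.reverse ++ ({m with
      inp := col ++ (Γ'.comma :: (row I a ++ Γ'.ket :: entriesFrom I (a + 1)))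
      done := Γ'.bra :: (entriesBefore I a).reverse} : Mem).stk t) = ({m' with
        inp := Γ'.comma :: (row I a ++ Γ'.ket :: entriesFrom I (a + 1))
        done := col.reverse ++ Γ'.bra :: (entriesBefore I a).reverse } : Mem).stk := by
    have e₁ : ∀ (m : Mem) (l l' : List Γ'), ({m with inp := l, done := l'} : Mem).stk =
        update (update m.stk .inp l) .done l' := by simp
    rw [e₁ m, e₁ m', ← hm']
    funext k
    by_cases hk : k = t
    · subst hk
      simp [ht.1, ht.2, -update_inp, -update_done]
    · by_cases hk₂ : k = .done
      · subst hk₂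
        simp [hk]
      · by_cases hk₁ : k = .inp
        · subst hk₁
          simp [hk]
        · simp [hk, hk₁, hk₂, -update_inp, -update_done]
  have h₄ := exec_rewind I (m := ({m' with
        inp := Γ'.comma :: (row I a ++ Γ'.ket :: entriesFrom I (a + 1))
        done := col.reverse ++ Γ'.bra :: (entriesBefore I a).reverse } : Mem)) (by
    rw [← entriesBefore_append I a, hentry]
    simp)
  refine (h₁.seq (h₂.seq ((h₃.to e le_rfl).seq h₄))).to ?_ ?_
  · have e₁ : m'.inp = entriesFrom I 0 := by
      rw [← stk_inp, ← hm', update_of_ne ht.1.symm, stk_inp, hinp]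
    have e₂ : m'.done = [] := by
      rw [← stk_done, ← hm', update_of_ne ht.2.symm, stk_done, hd]
    simp [← e₁, ← e₂]
  · have hn := n_le_bodyLength I
    have hp : col.length ≤ bodyLength I := by
      have := length_encodeVertex_le I a
      rw [encodeVertex_eq] at this
      simp [hcol] at this ⊢
      omega
    have : (a : ℕ) * (3 * bodyLength I + 9) ≤ bodyLength I * (3 * bodyLength I + 9) :=
      Nat.mul_le_mul_right _ (by omega)
    nlinarith

/-- Replace the top of `res` by `false`. -/
def refute : StackProg Stk := drop .res ⨟ push .res (Γ'.bit false)

theorem exec_refute {m : Mem} {s : Γ'} {R : List Γ'} (h : m.res = s :: R) :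
    Exec refute m.stk ({m with res := Γ'.bit false :: R} : Mem).stk 2 := by
  have h₁ := Exec.drop Stk.res m.stk
  rw [stk_res, h, List.tail_cons, update_res] at h₁
  refine (h₁.seq (Exec.push _ _ _)).to ?_ le_rfl
  simp

/-- Compare the tops of `c` and `d`, where `c` holds bits. -/
def eqStep : StackProg Stk :=
  ite .c (fun o => decide (o = some (Γ'.bit true)))
    (ite .d (fun o => decide (o = some (Γ'.bit true))) skip refute)
    (ite .d (fun o => decide (o = some (Γ'.bit false))) skip refute) ⨟ drop .c ⨟ drop .d

/-- An exhausted `d` has no top symbol, counts as a mismatch, and is not harmed by `drop`. -/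
theorem exec_eqStep {m : Mem} {x b : Bool} {l R : List Γ'} (hc : m.c = Γ'.bit x :: l)
    (hr : m.res = Γ'.bit b :: R) :
    Exec eqStep m.stk ({m with
      c := l
      d := m.d.tail
      res := Γ'.bit (b && decide (m.d.head? = some (Γ'.bit x))) :: R} : Mem).stk 6 := by
  have h₁ : Exec (ite .c (fun o => decide (o = some (Γ'.bit true)))
      (ite .d (fun o => decide (o = some (Γ'.bit true))) skip refute)
      (ite .d (fun o => decide (o = some (Γ'.bit false))) skip refute)) m.stk
      ({m with res := Γ'.bit (b && decide (m.d.head? = some (Γ'.bit x))) :: R} : Mem).stk 4 := by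
    have hyes : m.d.head? = some (Γ'.bit x) → Exec skip m.stk
      ({m with res := Γ'.bit (b && decide (m.d.head? = some (Γ'.bit x))) :: R} : Mem).stk 1 := by
      intro h
      refine (Exec.skip _).to ?_ le_rfl
      simp [h, ← hr]
    have hno : ¬ m.d.head? = some (Γ'.bit x) → Exec refute m.stk
      ({m with res := Γ'.bit (b && decide (m.d.head? = some (Γ'.bit x))) :: R} : Mem).stk 2 := by
      intro h
      refine (exec_refute hr).to ?_ le_rfl
      simp [h]
    by_cases h : m.d.head? = some (Γ'.bit x)
    · cases x with
      | true => exact (Exec.ite_true (by simp [hc]) (Exec.ite_true (by simp [h])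
          (hyes h))).mono (by omega)
      | false => exact (Exec.ite_false (by simp [hc]) (Exec.ite_true (by simp [h])
          (hyes h))).mono (by omega)
    · cases x with
      | true => exact (Exec.ite_true (by simp [hc]) (Exec.ite_false (by simp [h])
          (hno h))).mono (by omega)
      | false => exact (Exec.ite_false (by simp [hc]) (Exec.ite_false (by simp [h])
          (hno h))).mono (by omega)
  refine (h₁.seq ((Exec.drop _ _).seq (Exec.drop _ _))).to ?_ le_rfl
  simp [hc]

theorem exec_eqLoop {l : List Bool} {m : Mem} {b : Bool} {R : List Γ'} (hc : m.c = l.map Γ'.bit)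
    (hr : m.res = Γ'.bit b :: R) :
    Exec (loop .c (fun o => o.isSome) eqStep) m.stk ({m with
      c := []
      d := m.d.drop l.length
      res := Γ'.bit (b && decide (m.d.take l.length = l.map Γ'.bit)) :: R} : Mem).stk
      (7 * l.length + 1) := by
  induction l generalizing m b with
  | nil =>
    refine (Exec.loop_end (by simp [hc])).to ?_ (by simp)
    rw [List.map_nil] at hc
    simp [← hr, ← hc]
  | cons x l ih =>
    refine (Exec.loop_step (by simp [hc]) (exec_eqStep hc hr) (ih rfl rfl)).to ?_
      (by simp; omega)
    rcases hm : m.d with - | ⟨s, d⟩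
    · simp
    · by_cases hs : s = Γ'.bit x <;> simp [hs]

/-- Push whether `c` and `d` are equal, where `c` holds bits, and empty both. -/
def eqProg : StackProg Stk :=
  push .res (Γ'.bit true) ⨟ loop .c (fun o => o.isSome) eqStep ⨟
    ite .d (fun o => o.isSome) refute skip ⨟ clear .d

theorem exec_eqProg {l : List Bool} {m : Mem} (hc : m.c = l.map Γ'.bit) :
    Exec eqProg m.stk ({m with
      c := []
      d := []
      res := Γ'.bit (decide (m.d = l.map Γ'.bit)) :: m.res} : Mem).stk
      (7 * l.length + 2 * m.d.length + 6) := by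
  have h₁ := Exec.push Stk.res (Γ'.bit true) m.stk
  rw [stk_res, update_res] at h₁
  have h₂ := exec_eqLoop (m := {m with res := Γ'.bit true :: m.res}) hc rfl
  have h₃ : Exec (ite .d (fun o => o.isSome) refute skip) ({m with
      c := []
      d := m.d.drop l.length
      res := Γ'.bit (true && decide (m.d.take l.length = l.map Γ'.bit)) :: m.res} : Mem).stk ({m with
      c := []
      d := m.d.drop l.length
      res := Γ'.bit (decide (m.d = l.map Γ'.bit)) :: m.res} : Mem).stk 3 := by
    -- The loop compared only a prefix of `d`; anything left over on `d` refutes equality.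
    by_cases hd : m.d.length ≤ l.length
    · refine (Exec.ite_false (by simp [List.drop_eq_nil_of_le hd]) (Exec.skip _)).to ?_ (by omega)
      rw [List.take_of_length_le hd, Bool.true_and]
    · refine (Exec.ite_true ?_ (exec_refute rfl)).to ?_ le_rfl
      · have : m.d.drop l.length ≠ [] := by simpa using hd
        simpa [List.isSome_head?] using hd
      · have : m.d ≠ l.map Γ'.bit := fun h => hd (by simp [h])
        simp [this]
  refine (h₁.seq (h₂.seq (h₃.seq (Exec.clear _ _)))).to ?_ ?_
  · simp
  · simp
    omega

/-- Push whether the variable `u` has no precolor or that of the variable `w`. -/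
def compatProg (u w : Fin 8) : StackProg Stk :=
  colorProg u .c ⨟ colorProg w .d ⨟ ite .c (fun o => decide (o = some Γ'.blank))
    (clear .c ⨟ clear .d ⨟ push .res (Γ'.bit true)) eqProg

theorem encodeNat_injective : Function.Injective encodeNat := encodingNatBool.encode_injective

/-- Color zero is encoded by the empty word, so it is the blank, which is not a bit, that separates
"no precolor" from every color. -/
theorem encodeColor_eq_iff {ℓ : ℕ} {o : Option (Fin ℓ)} {a : Fin ℓ} :
    MHVInstance.encodeColor o = MHVInstance.encodeColor (some a) ↔ o = some a := by
  refine ⟨fun h => ?_, fun h => by rw [h]⟩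
  cases o with
  | none =>
    exfalso
    have : Γ'.blank ∈ (encodeNat a).map Γ'.bit := by
      simp only [MHVInstance.encodeColor] at h
      rw [← h]
      simp
    simp at this
  | some b =>
    simp only [MHVInstance.encodeColor] at h
    have := encodeNat_injective (List.map_injective_iff.2 (fun x y h => by simpa using h) h)
    rw [Fin.ext this]

/-- `u` has no precolor, or that of `w`. -/
def Compat (u w : Fin I.n) : Prop := I.p u = none ∨ I.p u = I.p w

open Classical in
-- Both precolors arrive reversed, which does not affect equality. If only `w` has no precolor, the
-- blank on `d` differs from any word of bits, so the comparison fails as it should.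
theorem exec_compatProg {m : Mem} {u w : Fin 8} (a b : Fin I.n) (hu : m.val u = ticks a)
    (hw : m.val w = ticks b) (ha : m.aux = []) (hinp : m.inp = entriesFrom I 0)
    (hd : m.done = []) (hmc : m.c = []) (hmd : m.d = []) :
    Exec (compatProg u w) m.stk
      ({m with res := Γ'.bit (decide (Compat I a b)) :: m.res} : Mem).stk
      (80 * (bodyLength I + 1) ^ 2) := by
  rcases m with ⟨inp, dn, aux, c, d, res, ell, kk, val, rest⟩
  dsimp only at *
  subst hmc hmd
  set ca := MHVInstance.encodeColor (I.p a) with hca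
  set cb := MHVInstance.encodeColor (I.p b) with hcb
  have hlen : ∀ v, (MHVInstance.encodeColor (I.p v)).length ≤ bodyLength I := fun v => by
    have := length_encodeVertex_le I v
    rw [encodeVertex_eq] at this
    simp at this
    omega
  have h₁ := exec_colorProg I (t := .c) (m := ⟨inp, dn, aux, [], [], res, ell, kk, val, rest⟩) a hu ha hinp hd (by simp)
    (m' := ⟨inp, dn, aux, ca.reverse, [], res, ell, kk, val, rest⟩) (by simp [hca])
  have h₂ := exec_colorProg I (t := .d) (m := ⟨inp, dn, aux, ca.reverse, [], res, ell, kk, val, rest⟩) b hw ha hinp hd (by simp)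
    (m' := ⟨inp, dn, aux, ca.reverse, cb.reverse, res, ell, kk, val, rest⟩) (by simp [hcb])
  have h₃ : Exec (ite .c (fun o => decide (o = some Γ'.blank))
      (clear .c ⨟ clear .d ⨟ push .res (Γ'.bit true)) eqProg)
      (⟨inp, dn, aux, ca.reverse, cb.reverse, res, ell, kk, val, rest⟩ : Mem).stk
      (⟨inp, dn, aux, [], [], Γ'.bit (decide (Compat I a b)) :: res, ell, kk, val, rest⟩ : Mem).stk
      (9 * bodyLength I + 7) := by
    have hla := hlen a
    have hlb := hlen b
    rcases hpa : I.p a with - | x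
    · have hc : Compat I a b := Or.inl hpa
      have hca' : ca = [Γ'.blank] := by rw [hca, hpa]; rfl
      refine (Exec.ite_true (by simp [hca']) ((Exec.clear _ _).seq ((Exec.clear _ _).seq
        (Exec.push _ _ _)))).to ?_ ?_
      · simp [hc]
      · simp [← hca, ← hcb] at hla hlb ⊢
        omega
    · have hca' : ca = (encodeNat x).map Γ'.bit := by rw [hca, hpa]; rfl
      have hiff : cb = (encodeNat x).map Γ'.bit ↔ Compat I a b := by
        rw [← hca', hca, hcb, hpa, encodeColor_eq_iff, Compat, hpa]
        simp [eq_comm]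
      refine (Exec.ite_false ?_ (exec_eqProg (l := (encodeNat x).reverse) ?_)).to ?_ ?_
      · simp only [stk_c, decide_eq_false_iff_not, hca']
        intro h
        have := List.mem_of_mem_head? h
        simp at this
      · simp [hca']
      · simp [hiff]
      · rw [← hca, hca'] at hla
        rw [← hcb] at hlb
        simp at hla hlb ⊢
        omega
  refine (h₁.seq (h₂.seq h₃)).mono ?_
  nlinarith

end MHVMachine

/-! ### Loops over all vertices, unary comparison and counting. -/

namespace MHVMachine

open StackProg

variable (I : MHVInstance)

/-- The contents of the stacks between the steps of the main program, with values `e` of the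
variables. -/
noncomputable def memOf (e : Fin 8 → ℕ) (d R kk : List Γ') : Mem where
  inp := entriesFrom I 0
  done := []
  aux := []
  c := []
  d := d
  res := R
  ell := (encodeNat I.ℓ).reverse.map Γ'.bit
  kk := kk
  val x := ticks (e x)
  rest x := ticks (I.n - e x)

theorem memOf_update (e : Fin 8 → ℕ) (x : Fin 8) (s : ℕ) (d R kk : List Γ') :
    memOf I (update e x s) d R kk = { memOf I e d R kk with
      val := update (memOf I e d R kk).val x (ticks s)
      rest := update (memOf I e d R kk).rest x (ticks (I.n - s)) } := by
  simp only [memOf, Mem.mk.injEq, true_and]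
  constructor <;> funext y <;> by_cases h : y = x <;> simp [h]

/-- Let the variable `x` run over all vertices. -/
def forVar (x : Fin 8) (P : StackProg Stk) : StackProg Stk :=
  loop (.rest x) (fun o => o.isSome) (P ⨟ mv (.rest x) (.val x)) ⨟ moveAll (.val x) (.rest x)

/-- `D`, `R` and `k` trace the stacks that the body may change. The value zero of `x` means that
`rest x` holds all `I.n` ticks; the final move restores this, so the loop can be nested and
repeated. -/
theorem exec_forVar {P : StackProg Stk} {T : ℕ} {e : Fin 8 → ℕ} {x : Fin 8} (hx : e x = 0)
    (D R k : ℕ → List Γ')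
    (h : ∀ s < I.n, Exec P (memOf I (update e x s) (D s) (R s) (k s)).stk
      (memOf I (update e x s) (D (s + 1)) (R (s + 1)) (k (s + 1))).stk T) :
    Exec (forVar x P) (memOf I e (D 0) (R 0) (k 0)).stk (memOf I e (D I.n) (R I.n) (k I.n)).stk
      (I.n * (T + 6) + 2) := by
  have h₁ := Exec.loop (P := P ⨟ mv (.rest x) (.val x)) (k := Stk.rest x)
    (b := fun o => o.isSome) (T := T + 2) I.n
    (fun s => (memOf I (update e x s) (D s) (R s) (k s)).stk)
    (fun s hs => by simp [memOf, head?_ticks_isSome, hs]) (by simp [memOf]) (fun s hs => by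
      refine (h s hs).seq ?_
      have hs' : I.n - s = (I.n - (s + 1)) + 1 := by omega
      refine (Exec.mv (s := Γ'.blank) (l := ticks (I.n - (s + 1))) (by simp) ?_).to ?_ le_rfl
      · simp only [memOf, stk_rest, update_self]
        rw [hs', ticks_succ]
      · simp [memOf_update, ticks_succ])
  have h₂ := Exec.moveAll (a := Stk.val x) (b := Stk.rest x) (by simp)
    (memOf I (update e x I.n) (D I.n) (R I.n) (k I.n)).stk
  have h₀ : update e x 0 = e := by rw [← hx, update_eq_self]
  have h₃ : memOf I e (D I.n) (R I.n) (k I.n) = { memOf I e (D I.n) (R I.n) (k I.n) with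
      val := update (memOf I e (D I.n) (R I.n) (k I.n)).val x (ticks 0)
      rest := update (memOf I e (D I.n) (R I.n) (k I.n)).rest x (ticks I.n) } := by
    have := memOf_update I e x 0 (D I.n) (R I.n) (k I.n)
    rwa [h₀, Nat.sub_zero] at this
  simp only [h₀] at h₁
  refine (h₁.seq h₂).to ?_ ?_
  · rw [h₃]
    simp [memOf_update]
  · simp [memOf]
    ring_nf
    omega

/-- Put the value of the variable `x` onto the stack `t`. -/
def copyVar (x : Fin 8) (t : Stk) : StackProg Stk :=
  moveAll (.val x) .aux ⨟ copyWhile (fun _ => true) .aux (.val x) t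

theorem exec_copyVar {x : Fin 8} {t : Stk} {m : Mem} {s : ℕ} (hx : m.val x = ticks s)
    (ha : m.aux = []) (ht : t ≠ .aux ∧ t ≠ .val x) :
    Exec (copyVar x t) m.stk (update m.stk t (ticks s ++ m.stk t)) (7 * s + 2) := by
  have h₁ := Exec.moveAll (a := Stk.val x) (b := Stk.aux) (by simp) m.stk
  have h₂ := Exec.copyWhile (p := fun _ => true) (a := Stk.aux) (b := Stk.val x) (c := t)
    (by simp) ht.1.symm ht.2.symm
    (S := update (update m.stk (Stk.val x) []) Stk.aux ((m.stk (Stk.val x)).reverse ++ m.stk Stk.aux))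
    (l₁ := ticks s) (l₂ := []) (by simp [hx, ha, -update_val, -update_aux]) (by simp) (by simp)
  refine (h₁.seq h₂).to ?_ ?_
  · funext k
    by_cases hk : k = t
    · subst hk
      simp [ht.1, ht.2, -update_val, -update_aux]
    · by_cases hk₁ : k = .aux
      · subst hk₁
        simp [hk, ha, -update_val, -update_aux]
      · by_cases hk₂ : k = .val x
        · subst hk₂
          simp [hk, hx, -update_val, -update_aux]
        · simp [hk, hk₁, hk₂, -update_val, -update_aux]
  · simp [hx]
    omega

/-- Push whether `c` is shorter than `d`, and empty both. -/
def shorterProg : StackProg Stk :=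
  loop .c (fun o => o.isSome) (drop .c ⨟ drop .d) ⨟
    ite .d (fun o => o.isSome) (push .res (Γ'.bit true)) (push .res (Γ'.bit false)) ⨟ clear .d

/-- Dropping `a` ticks from both stacks leaves `b - a` on `d`, which is nonzero iff `a < b`. -/
theorem exec_shorterProg {m : Mem} {a b : ℕ} (hc : m.c = ticks a) (hd : m.d = ticks b) :
    Exec shorterProg m.stk ({m with
      c := []
      d := []
      res := Γ'.bit (decide (a < b)) :: m.res} : Mem).stk (3 * a + 2 * b + 4) := by
  have h₁ := Exec.loop (P := drop .c ⨟ drop .d) (k := Stk.c) (b := fun o => o.isSome) (T := 2) a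
    (fun j => ({m with c := ticks (a - j), d := ticks (b - j)} : Mem).stk)
    (fun j hj => by simp [head?_ticks_isSome, hj]) (by simp) (fun j hj => by
      refine ((Exec.drop _ _).seq (Exec.drop _ _)).to ?_ le_rfl
      simp [Nat.sub_sub])
  have h₂ : Exec (ite .d (fun o => o.isSome) (push .res (Γ'.bit true)) (push .res (Γ'.bit false)))
      ({m with c := ticks (a - a), d := ticks (b - a)} : Mem).stk ({m with
        c := []
        d := ticks (b - a)
        res := Γ'.bit (decide (a < b)) :: m.res} : Mem).stk 2 := by
    by_cases hab : a < b
    · refine (Exec.ite_true (by simp [head?_ticks_isSome, hab]) (Exec.push _ _ _)).to ?_ le_rfl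
      simp [hab]
    · refine (Exec.ite_false (by simp [head?_ticks_isSome]; omega) (Exec.push _ _ _)).to ?_ le_rfl
      simp [hab]
  simp only [Nat.sub_zero, ← hc, ← hd] at h₁
  refine (h₁.seq (h₂.seq (Exec.clear _ _))).to ?_ ?_
  · simp
  · simp
    omega

/-- Replace two bits by the negation of their conjunction. -/
def nandProg : StackProg Stk :=
  ite .res (fun o => decide (o = some (Γ'.bit true)))
    (drop .res ⨟ ite .res (fun o => decide (o = some (Γ'.bit true)))
      (drop .res ⨟ push .res (Γ'.bit false)) (drop .res ⨟ push .res (Γ'.bit true)))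
    (drop .res ⨟ drop .res ⨟ push .res (Γ'.bit true))

theorem exec_nandProg {m : Mem} {a b : Bool} {R : List Γ'}
    (h : m.res = Γ'.bit b :: Γ'.bit a :: R) :
    Exec nandProg m.stk ({m with res := Γ'.bit (!(a && b)) :: R} : Mem).stk 5 := by
  cases b
  · refine (Exec.ite_false (by simp [h]) ((Exec.drop _ _).seq ((Exec.drop _ _).seq
      (Exec.push _ _ _)))).to ?_ (by omega)
    simp [h]
  · cases a
    · refine (Exec.ite_true (by simp [h]) ((Exec.drop _ _).seq (Exec.ite_false (by simp [h])
        ((Exec.drop _ _).seq (Exec.push _ _ _))))).to ?_ le_rfl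
      simp [h]
    · refine (Exec.ite_true (by simp [h]) ((Exec.drop _ _).seq (Exec.ite_true (by simp [h])
        ((Exec.drop _ _).seq (Exec.push _ _ _))))).to ?_ le_rfl
      simp [h]

/-- Move a bit from `res` into a count on `d`. -/
def tallyProg : StackProg Stk :=
  ite .res (fun o => decide (o = some (Γ'.bit true))) (drop .res ⨟ push .d Γ'.blank) (drop .res)

theorem exec_tallyProg {m : Mem} {b : Bool} {R : List Γ'} {s : ℕ} (hr : m.res = Γ'.bit b :: R)
    (hd : m.d = ticks s) :
    Exec tallyProg m.stk ({m with res := R, d := ticks (s + b.toNat)} : Mem).stk 3 := by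
  cases b
  · refine (Exec.ite_false (by simp [hr]) (Exec.drop _ _)).to ?_ (by omega)
    simp [hr, ← hd]
  · refine (Exec.ite_true (by simp [hr]) ((Exec.drop _ _).seq (Exec.push _ _ _))).to ?_ le_rfl
    simp [hr, hd, ticks_succ]

/-! ### First-order formulas with counting -/

/-- Formulas about an instance. The formula `cnt t x φ` says that more vertices `x` satisfy `φ`
than the value of the variable `t`. -/
inductive Formula : Type
  | adj (i j : Fin 8)
  | compat (u w : Fin 8)
  | lt (i j : Fin 8)
  | nand (φ ψ : Formula)
  | cnt (t x : Fin 8) (φ : Formula)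

namespace Formula

/-- The bound variables. -/
def bound : Formula → List (Fin 8)
  | nand φ ψ => φ.bound ++ ψ.bound
  | cnt _ x φ => x :: φ.bound
  | _ => []

/-- No variable is bound again within its scope. -/
def WellScoped : Formula → Prop
  | nand φ ψ => φ.WellScoped ∧ ψ.WellScoped
  | cnt _ x φ => x ∉ φ.bound ∧ φ.WellScoped
  | _ => True

open Classical in
/-- Satisfaction of a formula. -/
def Sat : Formula → (Fin 8 → Fin I.n) → Prop
  | adj i j, e => I.graph.Adj (e i) (e j)
  | compat u w, e => Compat I (e u) (e w)
  | lt i j, e => e i < e j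
  | nand φ ψ, e => ¬ (φ.Sat e ∧ ψ.Sat e)
  | cnt t x φ, e => (e t : ℕ) < (Finset.univ.filter fun a => φ.Sat (update e x a)).card

/-- The program that evaluates a formula. -/
def prog : Formula → StackProg Stk
  | adj i j => adjProg i j
  | compat u w => compatProg u w
  | lt i j => copyVar i .c ⨟ copyVar j .d ⨟ shorterProg
  | nand φ ψ => φ.prog ⨟ ψ.prog ⨟ nandProg
  | cnt t x φ => forVar x φ.prog ⨟ forVar x tallyProg ⨟ copyVar t .c ⨟ shorterProg

end Formula

theorem coe_update {n : ℕ} (e : Fin 8 → Fin n) (x : Fin 8) (a : Fin n) :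
    (fun y => (update e x a y : ℕ)) = update (fun y => (e y : ℕ)) x a := by
  funext y
  by_cases h : y = x
  · subst h
    simp
  · simp [h]

theorem card_filter_eq_count {n : ℕ} (p : Fin n → Prop) [DecidablePred p] :
    (Finset.univ.filter p).card = ((List.finRange n).map fun a => decide (p a)).count true := by
  rw [List.count_eq_countP, List.countP_map, Finset.card_def, Finset.filter_val, Fin.univ_def,
    Multiset.filter_coe, Multiset.coe_card, List.countP_eq_length_filter]
  simp [Function.comp_def]

theorem count_take_succ {l : List Bool} {s : ℕ} (hs : s < l.length) :
    (l.take (s + 1)).count true = (l.take s).count true + l[s].toNat := by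
  rw [List.take_succ_eq_append_getElem hs, List.count_append]
  cases l[s] <;> simp

/-- Count the bits on `res` that are left by a loop over all vertices. -/
theorem exec_forVar_tally {e : Fin 8 → ℕ} {x : Fin 8} (hx : e x = 0) (l : List Bool)
    (hl : l.length = I.n) (R kk : List Γ') :
    Exec (forVar x tallyProg) (memOf I e [] (l.map Γ'.bit ++ R) kk).stk
      (memOf I e (ticks (l.count true)) R kk).stk (I.n * 9 + 2) := by
  have := exec_forVar I (P := tallyProg) (T := 3) hx (fun s => ticks ((l.take s).count true))
    (fun s => (l.drop s).map Γ'.bit ++ R) (fun _ => kk) (fun s hs => by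
      have hs' : s < l.length := by omega
      refine (exec_tallyProg (b := l[s]) (R := (l.drop (s + 1)).map Γ'.bit ++ R)
        (s := (l.take s).count true) ?_ rfl).to ?_ le_rfl
      · simp only [memOf]
        rw [List.drop_eq_getElem_cons hs']
        rfl
      · rw [← count_take_succ hs']
        rfl)
  have ht : l.take I.n = l := List.take_of_length_le hl.le
  have hd : l.drop I.n = [] := List.drop_eq_nil_of_le hl.le
  simp only [ht, hd, List.take_zero, List.drop_zero, List.count_nil, List.map_nil,
    List.nil_append] at this
  exact this

namespace Formula

open Classical in
-- The polynomial depends on the formula only. Each counting quantifier costs one loop over the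
-- vertices, hence essentially one further factor of the input length. Bound variables are required
-- to be zero because a loop over `x` must start with `x` at its initial value.
theorem exists_exec (φ : Formula) (hφ : φ.WellScoped) :
    ∃ T : Polynomial ℕ, ∀ (I : MHVInstance) (e : Fin 8 → Fin I.n) (R kk : List Γ'),
      (∀ x ∈ φ.bound, (e x : ℕ) = 0) →
      Exec φ.prog (memOf I (fun x => e x) [] R kk).stk
        (memOf I (fun x => e x) [] (Γ'.bit (decide (φ.Sat I e)) :: R) kk).stk
        (T.eval (bodyLength I)) := by
  induction φ with
  | adj i j =>
    refine ⟨30 * (Polynomial.X + 1) ^ 2, fun I e R kk _ => ?_⟩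
    refine (exec_adjProg I (e i) (e j) rfl rfl rfl rfl rfl).to rfl ?_
    simp
  | compat u w =>
    refine ⟨80 * (Polynomial.X + 1) ^ 2, fun I e R kk _ => ?_⟩
    refine (exec_compatProg I (e u) (e w) rfl rfl rfl rfl rfl rfl rfl).to rfl ?_
    simp
  | lt i j =>
    refine ⟨20 * (Polynomial.X + 1), fun I e R kk _ => ?_⟩
    have h₁ := exec_copyVar (x := i) (t := .c) (m := memOf I (fun x => e x) [] R kk) rfl rfl
      (by simp)
    rw [update_c] at h₁
    have h₂ := exec_copyVar (x := j) (t := .d) (m := { memOf I (fun x => e x) [] R kk with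
      c := ticks (e i) ++ [] }) rfl rfl (by simp)
    rw [update_d] at h₂
    have h₃ := exec_shorterProg (m := { memOf I (fun x => e x) [] R kk with
      c := ticks (e i) ++ [], d := ticks (e j) ++ [] }) (a := e i) (b := e j) (by simp) (by simp)
    refine (h₁.seq (h₂.seq h₃)).to ?_ ?_
    · exact congrArg (fun b => (memOf I (fun x => e x) [] (Γ'.bit b :: R) kk).stk)
        (decide_eq_decide.2 Iff.rfl)
    · have := n_le_bodyLength I
      have := (e i).2
      have := (e j).2
      simp
      omega
  | nand φ ψ ihφ ihψ =>
    obtain ⟨T₁, h₁⟩ := ihφ hφ.1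
    obtain ⟨T₂, h₂⟩ := ihψ hφ.2
    refine ⟨T₁ + T₂ + 5, fun I e R kk he => ?_⟩
    refine ((h₁ I e R kk fun x hx => he x (by simp [bound, hx])).seq
      ((h₂ I e _ kk fun x hx => he x (by simp [bound, hx])).seq (exec_nandProg rfl))).to ?_ ?_
    · simp [memOf, Sat]
    · simp
      omega
  | cnt t x φ ih =>
    obtain ⟨T, h⟩ := ih hφ.2
    refine ⟨Polynomial.X * (T + 30) + 30, fun I e R kk he => ?_⟩
    have hx : (e x : ℕ) = 0 := he x (by simp [bound])
    set l := (List.finRange I.n).map fun a => decide (φ.Sat I (update e x a)) with hl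
    have hlen : l.length = I.n := by simp [hl]
    -- The truth values pile up on `res` in reverse order, which is harmless for counting.
    have h₁ := exec_forVar I (P := φ.prog) (T := T.eval (bodyLength I)) (e := fun x => (e x : ℕ)) hx
      (fun _ => []) (fun s => ((l.take s).reverse).map Γ'.bit ++ R) (fun _ => kk) (fun s hs => by
        have hs' : s < l.length := by omega
        refine (coe_update e x ⟨s, hs⟩ ▸ h I (update e x ⟨s, hs⟩)
          (((l.take s).reverse).map Γ'.bit ++ R) kk (fun y hy => ?_)).to ?_ le_rfl
        -- Inside the loop `x` is no longer zero; well-scopedness guarantees that `φ` does not bind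
        -- it again.
        · rw [update_of_ne (by rintro rfl; exact hφ.1 hy)]
          exact he y (by simp [bound, hy])
        · rw [List.take_succ_eq_append_getElem hs', List.reverse_append]
          simp [hl])
    have h₂ := exec_forVar_tally I (e := fun x => (e x : ℕ)) hx l.reverse (by simp [hlen]) R kk
    have h₃ := exec_copyVar (x := t) (t := .c)
      (m := memOf I (fun x => e x) (ticks (l.reverse.count true)) R kk) rfl rfl (by simp)
    rw [update_c] at h₃
    have h₄ := exec_shorterProg
      (m := { memOf I (fun x => e x) (ticks (l.reverse.count true)) R kk with
        c := ticks (e t) ++ [] }) (a := e t) (b := l.reverse.count true) (by simp) rfl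
    rw [List.take_of_length_le hlen.le] at h₁
    have hcount : l.count true ≤ I.n := hlen ▸ List.count_le_length
    refine (h₁.seq (h₂.seq (h₃.seq h₄))).to ?_ ?_
    · have hc := card_filter_eq_count fun a => φ.Sat I (update e x a)
      rw [List.count_reverse]
      simp only [Sat, hc, ← hl]
      rfl
    · have hn := n_le_bodyLength I
      have ht := (e t).2
      rw [List.count_reverse]
      simp only [Polynomial.eval_add, Polynomial.eval_mul, Polynomial.eval_X,
        Polynomial.eval_ofNat]
      have := Nat.mul_le_mul_right (Polynomial.eval (bodyLength I) T + 30) hn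
      nlinarith

end Formula

end MHVMachine

namespace MHVMachine

open StackProg

/-! ### Binary numbers -/

/-- The value of a list of bits, with the least significant bit first. -/
def natVal : List Bool → ℕ
  | [] => 0
  | b :: l => b.toNat + 2 * natVal l

theorem natVal_encodePosNum (n : PosNum) : natVal (encodePosNum n) = n := by
  induction n with
  | one => rfl
  | bit0 n ih =>
    rw [encodePosNum, natVal, ih, PosNum.cast_bit0]
    simp
    omega
  | bit1 n ih =>
    rw [encodePosNum, natVal, ih, PosNum.cast_bit1]
    simp
    omega

theorem natVal_encodeNat (n : ℕ) : natVal (encodeNat n) = n := by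
  conv_rhs => rw [← Num.to_of_nat n]
  unfold encodeNat
  cases (n : Num) with
  | zero => rfl
  | pos m => exact natVal_encodePosNum m

theorem encodeNat_eq_nil {n : ℕ} : encodeNat n = [] ↔ n = 0 := by
  refine ⟨fun h => ?_, fun h => by rw [h]; rfl⟩
  rw [← natVal_encodeNat n, h]
  rfl

theorem natVal_replicate_false (z : ℕ) (l : List Bool) :
    natVal (List.replicate z false ++ l) = 2 ^ z * natVal l := by
  induction z with
  | zero => simp
  | succ z ih =>
    rw [List.replicate_succ, List.cons_append, natVal, ih]
    simp
    ring

theorem natVal_replicate_true (z : ℕ) (l : List Bool) :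
    natVal (List.replicate z true ++ l) + 1 = 2 ^ z * (natVal l + 1) := by
  induction z with
  | zero => simp
  | succ z ih =>
    rw [List.replicate_succ, List.cons_append, natVal, pow_succ, mul_assoc, mul_left_comm, ← ih]
    simp
    ring

/-- Subtract one from a binary number. -/
def decBits (l : List Bool) : List Bool :=
  match l.dropWhile (fun b => !b) with
  | [] => []
  | _ :: r => List.replicate (l.takeWhile fun b => !b).length true ++ false :: r

/-- Borrowing turns the low zeros into ones and the first one into a zero; without a one the number
is zero. -/
theorem bits_cases (l : List Bool) : (∃ z, l = List.replicate z false ∧ decBits l = []) ∨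
    ∃ z r, l = List.replicate z false ++ true :: r ∧
      decBits l = List.replicate z true ++ false :: r := by
  have h₁ : l.takeWhile (fun b => !b) =
      List.replicate (l.takeWhile fun b => !b).length false := by
    refine List.eq_replicate_iff.2 ⟨rfl, fun b hb => ?_⟩
    simpa using List.mem_takeWhile_imp hb
  have h₂ := List.takeWhile_append_dropWhile (p := fun b => !b) (l := l)
  rcases hd : l.dropWhile (fun b => !b) with - | ⟨b, r⟩
  · left
    refine ⟨(l.takeWhile fun b => !b).length, ?_, by simp [decBits, hd]⟩
    rw [hd, List.append_nil] at h₂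
    rw [← h₁, h₂]
  · right
    have hb : b = true := by
      have := List.head?_dropWhile_not (fun b => !b) l
      rw [hd] at this
      simpa using this
    refine ⟨(l.takeWhile fun b => !b).length, r, ?_, by simp only [decBits, hd]⟩
    rw [← h₁, ← hb, ← hd, h₂]

/-- The subtraction is truncated: zero stays zero. This is why superfluous decrements are harmless
when `k` is below the optimum. -/
theorem natVal_decBits (l : List Bool) : natVal (decBits l) = natVal l - 1 := by
  rcases bits_cases l with ⟨z, h, h'⟩ | ⟨z, r, h, h'⟩
  · have := natVal_replicate_false z []
    rw [List.append_nil] at this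
    rw [h', h, this]
    rfl
  · have h₁ := natVal_replicate_true z (false :: r)
    have h₂ := natVal_replicate_false z (true :: r)
    rw [h', show natVal l = _ from congrArg natVal h, h₂]
    have e : natVal (true :: r) = natVal (false :: r) + 1 := by
      simp [natVal]
      omega
    rw [e]
    omega

theorem length_decBits_le (l : List Bool) : (decBits l).length ≤ l.length := by
  rcases bits_cases l with ⟨z, h, h'⟩ | ⟨z, r, h, h'⟩
  · simp [h']
  · simp [h', show l.length = _ from congrArg List.length h]

theorem natVal_iterate_decBits (n : ℕ) (l : List Bool) :
    natVal (decBits^[n] l) = natVal l - n := by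
  induction n generalizing l with
  | zero => rfl
  | succ n ih =>
    rw [iterate_succ_apply, ih, natVal_decBits]
    omega

theorem length_iterate_decBits_le (n : ℕ) (l : List Bool) :
    (decBits^[n] l).length ≤ l.length := by
  induction n generalizing l with
  | zero => rfl
  | succ n ih =>
    rw [iterate_succ_apply]
    exact (ih _).trans (length_decBits_le l)

/-- Subtract one from the number on `kk`. -/
def decProg : StackProg Stk :=
  loop .kk (fun o => decide (o = some (Γ'.bit false))) (drop .kk ⨟ push .aux (Γ'.bit true)) ⨟
    ite .kk (fun o => o.isSome) (drop .kk ⨟ push .kk (Γ'.bit false) ⨟ moveAll .aux .kk) (clear .aux)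

theorem exec_decProg {m : Mem} {l : List Bool} (hk : m.kk = l.map Γ'.bit) (ha : m.aux = []) :
    Exec decProg m.stk ({m with kk := (decBits l).map Γ'.bit} : Mem).stk (6 * l.length + 10) := by
  -- The loop performs the borrow, with the new ones waiting on `aux`. If nothing remains on `kk`,
  -- the number was zero and `aux` is discarded.
  have hloop : ∀ (z : ℕ) (r : List Bool), r.head? ≠ some false →
      l = List.replicate z false ++ r →
      Exec (loop .kk (fun o => decide (o = some (Γ'.bit false)))
        (drop .kk ⨟ push .aux (Γ'.bit true))) m.stk ({m with
          kk := r.map Γ'.bit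
          aux := List.replicate z (Γ'.bit true)} : Mem).stk (z * 3 + 1) := by
    intro z r hr hl
    have := Exec.loop (P := drop .kk ⨟ push .aux (Γ'.bit true)) (k := Stk.kk)
      (b := fun o => decide (o = some (Γ'.bit false))) (T := 2) z
      (fun j => ({m with
        kk := (List.replicate (z - j) false ++ r).map Γ'.bit
        aux := List.replicate j (Γ'.bit true)} : Mem).stk)
      (fun j hj => by
        have : z - j = (z - (j + 1)) + 1 := by omega
        simp only [stk_kk]
        rw [this, List.replicate_succ]
        simp)
      (by rcases r with - | ⟨b, r⟩ <;> simp_all)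
      (fun j hj => by
        have : z - j = (z - (j + 1)) + 1 := by omega
        refine ((Exec.drop _ _).seq (Exec.push _ _ _)).to ?_ le_rfl
        simp only [stk_kk]
        rw [this, List.replicate_succ]
        simp [List.replicate_succ])
    simpa [← hl, ← hk, ← ha] using this
  rcases bits_cases l with ⟨z, h, h'⟩ | ⟨z, r, h, h'⟩
  · refine ((hloop z [] (by simp) (by simpa using h)).seq
      (Exec.ite_false (by simp) (Exec.clear _ _))).to ?_ ?_
    · simp [h', ha]
    · have := congrArg List.length h
      simp at this ⊢
      omega
  · refine ((hloop z (true :: r) (by simp) h).seq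
      (Exec.ite_true (by simp) ((Exec.drop _ _).seq ((Exec.push _ _ _).seq
        (Exec.moveAll (by decide) _))))).to ?_ ?_
    · simp [h', ha]
    · have := congrArg List.length h
      simp at this ⊢
      omega

/-- If the top of `res` is `true`, subtract one from `kk`. -/
def decIfProg : StackProg Stk :=
  ite .res (fun o => decide (o = some (Γ'.bit true))) (drop .res ⨟ decProg) (drop .res)

theorem exec_decIfProg {m : Mem} {l : List Bool} {b : Bool} {R : List Γ'}
    (hk : m.kk = l.map Γ'.bit) (ha : m.aux = []) (hr : m.res = Γ'.bit b :: R) :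
    Exec decIfProg m.stk ({m with
      res := R
      kk := (decBits^[b.toNat] l).map Γ'.bit} : Mem).stk (6 * l.length + 12) := by
  cases b
  · refine (Exec.ite_false (by simp [hr]) (Exec.drop _ _)).to ?_ (by omega)
    simp [hr, ← hk]
  · have h := Exec.drop Stk.res m.stk
    rw [update_res] at h
    refine (Exec.ite_true (by simp [hr]) (h.seq (exec_decProg hk ha))).to ?_ (by omega)
    simp [hr]

/-- Decrements of successive rounds add up. They never lengthen the number, so the bound `B`, and
with it the time `T` of a round, stays valid throughout. -/
theorem exec_forVar_dec (I : MHVInstance) {P : StackProg Stk} {T B : ℕ} {e : Fin 8 → ℕ}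
    {x : Fin 8} (hx : e x = 0) (g : Fin I.n → ℕ)
    (h : ∀ (a : Fin I.n) (l : List Bool), l.length ≤ B →
      Exec P (memOf I (update e x a) [] [] (l.map Γ'.bit)).stk
        (memOf I (update e x a) [] [] ((decBits^[g a] l).map Γ'.bit)).stk T)
    (l : List Bool) (hl : l.length ≤ B) :
    Exec (forVar x P) (memOf I e [] [] (l.map Γ'.bit)).stk
      (memOf I e [] [] ((decBits^[∑ a, g a] l).map Γ'.bit)).stk (I.n * (T + 6) + 2) := by
  have hlen : ((List.finRange I.n).map g).length = I.n := by simp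
  have := exec_forVar I (P := P) (T := T) hx (fun _ => []) (fun _ => [])
    (fun s => (decBits^[(((List.finRange I.n).map g).take s).sum] l).map Γ'.bit) (fun s hs => by
      have hs' : s < ((List.finRange I.n).map g).length := by omega
      refine (h ⟨s, hs⟩ _ ((length_iterate_decBits_le _ _).trans hl)).to ?_ le_rfl
      rw [← iterate_add_apply, List.take_succ_eq_append_getElem hs', List.sum_append, Nat.add_comm]
      simp)
  rw [List.take_of_length_le hlen.le] at this
  rw [Fin.sum_univ_def]
  exact this

/-! ### Reading the input -/

/-- Push a tick on each stack `rest x`. -/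
def pushRests : List (Fin 8) → StackProg Stk
  | [] => skip
  | x :: l => push (.rest x) Γ'.blank ⨟ pushRests l

theorem exec_pushRests {l : List (Fin 8)} (hl : l.Nodup) (m : Mem) :
    Exec (pushRests l) m.stk ({m with
      rest := fun x => if x ∈ l then Γ'.blank :: m.rest x else m.rest x} : Mem).stk
      (l.length + 1) := by
  induction l generalizing m with
  | nil => exact (Exec.skip _).to (by simp) (by simp)
  | cons x l ih =>
    have h₁ := Exec.push (Stk.rest x) Γ'.blank m.stk
    rw [update_rest] at h₁
    refine (h₁.seq (ih (List.nodup_cons.1 hl).2 _)).to ?_ (by simp; omega)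
    congr 2
    funext y
    have hx := (List.nodup_cons.1 hl).1
    by_cases h : y = x
    · subst h
      simp [hx]
    · simp [h]

/-- Empty each stack `rest x`. -/
def clearRests : List (Fin 8) → StackProg Stk
  | [] => skip
  | x :: l => clear (.rest x) ⨟ clearRests l

theorem exec_clearRests (l : List (Fin 8)) {m : Mem} {B : ℕ} (hm : ∀ x, (m.rest x).length ≤ B) :
    Exec (clearRests l) m.stk ({m with
      rest := fun x => if x ∈ l then [] else m.rest x} : Mem).stk
      (l.length * (2 * B + 1) + 1) := by
  induction l generalizing m with
  | nil => exact (Exec.skip _).to (by simp) (by simp)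
  | cons x l ih =>
    have h₁ := Exec.clear (Stk.rest x) m.stk
    rw [update_rest] at h₁
    refine (h₁.seq (ih (m := {m with rest := update m.rest x []}) fun y => ?_)).to ?_ ?_
    · by_cases h : y = x
      · subst h
        simp
      · simp [h, hm]
    · congr 2
      funext y
      by_cases h : y = x
      · subst h
        simp
      · simp [h]
    · have := hm x
      simp
      ring_nf
      omega

/-- Count the vertices into all stacks `rest x`. -/
def countProg : StackProg Stk :=
  loop .inp (fun o => o.isSome) (ite .inp (fun o => decide (o = some Γ'.ket))
    (pushRests (List.finRange 8)) skip ⨟ mv .inp .done)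

theorem exec_countProg {l : List Γ'} {m : Mem} (hl : m.inp = l) :
    Exec countProg m.stk ({m with
      inp := []
      done := l.reverse ++ m.done
      rest := fun x => ticks (l.count Γ'.ket) ++ m.rest x} : Mem).stk (13 * l.length + 1) := by
  induction l generalizing m with
  | nil =>
    refine (Exec.loop_end (by simp [hl])).to ?_ (by simp)
    cases m
    simp only at hl
    simp [hl]
  | cons s l ih =>
    have h₁ : Exec (ite .inp (fun o => decide (o = some Γ'.ket))
        (pushRests (List.finRange 8)) skip) m.stk ({m with
          rest := fun x => ticks (if s = Γ'.ket then 1 else 0) ++ m.rest x} : Mem).stk 10 := by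
      by_cases hs : s = Γ'.ket
      · refine (Exec.ite_true (by simp [hl, hs])
          (exec_pushRests (List.nodup_finRange 8) m)).to ?_ (by simp)
        simp [hs]
      · refine (Exec.ite_false (by simp [hl, hs]) (Exec.skip _)).to ?_ (by simp)
        simp [hs]
    have h₂ := Exec.mv (a := Stk.inp) (b := Stk.done) (by decide) (S := ({m with
          rest := fun x => ticks (if s = Γ'.ket then 1 else 0) ++ m.rest x} : Mem).stk)
          (s := s) (l := l) hl
    rw [update_inp, update_done] at h₂
    refine (Exec.loop_step (by simp [hl]) (h₁.seq h₂) (ih rfl)).to ?_ (by simp; omega)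
    have e : ∀ R : List Γ', ticks (l.count Γ'.ket) ++ (ticks (if s = Γ'.ket then 1 else 0) ++ R) =
        ticks ((s :: l).count Γ'.ket) ++ R := by
      intro R
      rw [← List.append_assoc, ← List.replicate_add, List.count_cons]
      simp
    simp only [e, List.reverse_cons, List.append_assoc]
    rfl

/-- Read the input. -/
def readProg : StackProg Stk :=
  moveWhile (fun s => decide (s ≠ Γ'.comma)) .inp .ell ⨟ drop .inp ⨟
    moveWhile (fun s => decide (s ≠ Γ'.comma)) .inp .aux ⨟ drop .inp ⨟ moveAll .aux .kk ⨟
    countProg ⨟ rewind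

theorem bits_ne_comma (l : List Bool) : ∀ s ∈ l.map Γ'.bit, decide (s ≠ Γ'.comma) = true := by
  intro s hs
  obtain ⟨b, -, rfl⟩ := List.mem_map.1 hs
  simp

theorem encode_eq (I : MHVInstance) : I.encode = (encodeNat I.ℓ).map Γ'.bit ++
    (Γ'.comma :: ((encodeNat I.k).map Γ'.bit ++ (Γ'.comma :: entriesFrom I 0))) := by
  simp [MHVInstance.encode, entriesFrom]

/-- The number of vertices is not written in the input; it is recovered by counting closing
brackets, one per entry. -/
theorem count_entries (I : MHVInstance) : (entriesFrom I 0).count Γ'.ket = I.n := by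
  have h : ∀ v, (I.encodeVertex v).count Γ'.ket = 1 := by
    intro v
    have h₁ : Γ'.ket ∉ MHVInstance.encodeColor (I.p v) := fun h => (mem_encodeColor h).1 rfl
    have h₂ : Γ'.ket ∉ row I v := fun h => by
      obtain ⟨b, hb⟩ := mem_row I h
      simp at hb
    rw [encodeVertex_eq]
    simp [List.count_eq_zero_of_not_mem h₁, List.count_eq_zero_of_not_mem h₂]
  simp [entriesFrom, List.count_flatMap, Function.comp_def, h]

/-- The detour through `aux` reverses `k` twice, so its least significant bit is on top of `kk`. The
number `ℓ` stays reversed, as only its being zero will be tested. -/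
theorem exec_readProg (I : MHVInstance) :
    Exec readProg (update (fun _ => []) Stk.inp I.encode)
      (memOf I (fun _ => 0) [] [] ((encodeNat I.k).map Γ'.bit)).stk (30 * I.encode.length + 10) := by
  have h₀ : update (fun _ => []) Stk.inp I.encode = (⟨(encodeNat I.ℓ).map Γ'.bit ++
      (Γ'.comma :: ((encodeNat I.k).map Γ'.bit ++ (Γ'.comma :: entriesFrom I 0))),
      [], [], [], [], [], [], [], fun _ => [], fun _ => []⟩ : Mem).stk := by
    funext k
    cases k <;> simp [encode_eq, Mem.stk]
  have h₁ := Exec.moveWhile (p := fun s => decide (s ≠ Γ'.comma)) (a := Stk.inp) (b := Stk.ell)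
    (by decide) (S := (⟨(encodeNat I.ℓ).map Γ'.bit ++
      (Γ'.comma :: ((encodeNat I.k).map Γ'.bit ++ (Γ'.comma :: entriesFrom I 0))),
      [], [], [], [], [], [], [], fun _ => [], fun _ => []⟩ : Mem).stk) rfl (bits_ne_comma _) (by simp)
  have h₂ := Exec.moveWhile (p := fun s => decide (s ≠ Γ'.comma)) (a := Stk.inp) (b := Stk.aux)
    (by decide) (S := (⟨(encodeNat I.k).map Γ'.bit ++ (Γ'.comma :: entriesFrom I 0),
      [], [], [], [], [], ((encodeNat I.ℓ).map Γ'.bit).reverse, [], fun _ => [],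
      fun _ => []⟩ : Mem).stk) rfl (bits_ne_comma _) (by simp)
  have h₃ := Exec.moveAll (a := Stk.aux) (b := Stk.kk) (by decide) (⟨entriesFrom I 0,
      [], ((encodeNat I.k).map Γ'.bit).reverse, [], [], [], ((encodeNat I.ℓ).map Γ'.bit).reverse,
      [], fun _ => [], fun _ => []⟩ : Mem).stk
  have h₄ := exec_countProg (m := (⟨entriesFrom I 0,
      [], [], [], [], [], ((encodeNat I.ℓ).map Γ'.bit).reverse,
      (encodeNat I.k).map Γ'.bit, fun _ => [], fun _ => []⟩ : Mem)) rfl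
  have h₅ := exec_rewind I (m := (⟨[], (entriesFrom I 0).reverse,
      [], [], [], [], ((encodeNat I.ℓ).map Γ'.bit).reverse,
      (encodeNat I.k).map Γ'.bit, fun _ => [], fun _ => ticks I.n⟩ : Mem)) (by simp)
  simp only [update_inp, update_ell, update_aux, update_kk, stk_aux, stk_ell, stk_kk,
    List.reverse_reverse, List.append_nil, count_entries] at h₁ h₂ h₃ h₄
  have d₁ := Exec.drop Stk.inp (⟨Γ'.comma :: ((encodeNat I.k).map Γ'.bit ++
      (Γ'.comma :: entriesFrom I 0)),
      [], [], [], [], [], ((encodeNat I.ℓ).map Γ'.bit).reverse, [], fun _ => [],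
      fun _ => []⟩ : Mem).stk
  have d₂ := Exec.drop Stk.inp (⟨Γ'.comma :: entriesFrom I 0,
      [], ((encodeNat I.k).map Γ'.bit).reverse, [], [], [], ((encodeNat I.ℓ).map Γ'.bit).reverse,
      [], fun _ => [], fun _ => []⟩ : Mem).stk
  rw [update_inp] at d₁ d₂
  rw [h₀]
  refine (h₁.seq (d₁.seq (h₂.seq (d₂.seq (h₃.seq (h₄.seq h₅)))))).to ?_ ?_
  · simp [memOf]
  · rw [encode_eq, bodyLength]
    simp
    omega

/-! ### The result -/

/-- Check that `kk` is zero and that `ell` is not. -/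
def checkProg : StackProg Stk :=
  push .res (Γ'.bit true) ⨟ loop .kk (fun o => o.isSome)
    (ite .kk (fun o => decide (o = some (Γ'.bit true))) refute skip ⨟ drop .kk) ⨟
    ite .ell (fun o => o.isSome) skip refute ⨟
    clear .inp ⨟ clear .ell ⨟ clearRests (List.finRange 8)

/-- Decrementing may leave leading zeros, so being zero means having no one among the bits, not
being the empty word. -/
theorem exec_zeroLoop {l : List Bool} {m : Mem} {b : Bool} {R : List Γ'} (hk : m.kk = l.map Γ'.bit)
    (hr : m.res = Γ'.bit b :: R) :
    Exec (loop .kk (fun o => o.isSome)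
      (ite .kk (fun o => decide (o = some (Γ'.bit true))) refute skip ⨟ drop .kk)) m.stk ({m with
        kk := []
        res := Γ'.bit (b && decide (natVal l = 0)) :: R} : Mem).stk (5 * l.length + 1) := by
  induction l generalizing m b with
  | nil =>
    refine (Exec.loop_end (by simp [hk])).to ?_ (by simp)
    rw [List.map_nil] at hk
    simp [natVal, ← hr, ← hk]
  | cons x l ih =>
    have h₁ : Exec (ite .kk (fun o => decide (o = some (Γ'.bit true))) refute skip) m.stk
        ({m with res := Γ'.bit (b && !x) :: R} : Mem).stk 3 := by
      cases x
      · refine (Exec.ite_false (by simp [hk]) (Exec.skip _)).to ?_ (by omega)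
        simp [← hr]
      · refine (Exec.ite_true (by simp [hk]) (exec_refute hr)).to ?_ (by omega)
        simp
    have h₂ := Exec.drop Stk.kk ({m with res := Γ'.bit (b && !x) :: R} : Mem).stk
    rw [update_kk] at h₂
    refine (Exec.loop_step (by simp [hk]) (h₁.seq h₂) (ih ?_ rfl)).to ?_ (by simp; omega)
    · simp [hk]
    · cases x <;> simp [natVal]

theorem exec_checkProg (I : MHVInstance) (l : List Bool) :
    Exec checkProg (memOf I (fun _ => 0) [] [] (l.map Γ'.bit)).stk
      (update (fun _ => []) Stk.res [Γ'.bit (decide (natVal l = 0) && decide (I.ℓ ≠ 0))])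
      (5 * l.length + 40 * I.encode.length + 50) := by
  have h₁ := Exec.push Stk.res (Γ'.bit true) (memOf I (fun _ => 0) [] [] (l.map Γ'.bit)).stk
  rw [update_res] at h₁
  have h₂ := exec_zeroLoop (l := l) (R := []) (b := true)
    (m := {memOf I (fun _ => 0) [] [] (l.map Γ'.bit) with res := [Γ'.bit true]}) rfl rfl
  set m₂ : Mem := {memOf I (fun _ => 0) [] [] (l.map Γ'.bit) with
    kk := []
    res := [Γ'.bit (true && decide (natVal l = 0))]} with hm₂
  have h₃ : Exec (ite .ell (fun o => o.isSome) skip refute) m₂.stk ({m₂ with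
      res := [Γ'.bit (decide (natVal l = 0) && decide (I.ℓ ≠ 0))]} : Mem).stk 3 := by
    by_cases h : I.ℓ = 0
    · refine (Exec.ite_false ?_ (exec_refute rfl)).to ?_ le_rfl
      · simp [hm₂, memOf, encodeNat_eq_nil.2 h]
      · simp [h]
    · refine (Exec.ite_true ?_ (Exec.skip _)).to ?_ (by omega)
      · have := mt encodeNat_eq_nil.1 h
        simpa [hm₂, memOf, List.isSome_head?] using this
      · simp [h, hm₂]
  have h₄ := exec_clearRests (List.finRange 8) (m := {m₂ with
    res := [Γ'.bit (decide (natVal l = 0) && decide (I.ℓ ≠ 0))]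
    inp := []
    ell := [] }) (B := I.n) (fun x => by simp [hm₂, memOf])
  have c₁ := Exec.clear Stk.inp ({m₂ with
      res := [Γ'.bit (decide (natVal l = 0) && decide (I.ℓ ≠ 0))]} : Mem).stk
  rw [update_inp] at c₁
  have c₂ := Exec.clear Stk.ell ({m₂ with
      res := [Γ'.bit (decide (natVal l = 0) && decide (I.ℓ ≠ 0))]
      inp := [] } : Mem).stk
  rw [update_ell] at c₂
  refine (h₁.seq (h₂.seq (h₃.seq (c₁.seq (c₂.seq h₄))))).to ?_ ?_
  · funext k
    cases k <;> simp [Mem.stk, hm₂, memOf]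
  · have hn := n_le_bodyLength I
    have hb : bodyLength I + (encodeNat I.ℓ).length ≤ I.encode.length := by
      rw [encode_eq, bodyLength]
      simp
      omega
    have : (entriesFrom I 0).length = bodyLength I := rfl
    simp [hm₂, memOf, this]
    omega

end MHVMachine

namespace MHVMachine

/-! ### Happy vertices of cographs -/

section Graph

variable {V : Type} {G : SimpleGraph V}

/-- `a` and `b` are at distance at most two. -/
def Near (G : SimpleGraph V) (a b : V) : Prop := a = b ∨ G.Adj a b ∨ ∃ y, G.Adj a y ∧ G.Adj y b

theorem Near.symm {a b : V} (h : Near G a b) : Near G b a := by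
  rcases h with rfl | h | ⟨y, h₁, h₂⟩
  · exact Or.inl rfl
  · exact Or.inr (Or.inl h.symm)
  · exact Or.inr (Or.inr ⟨y, h₂.symm, h₁.symm⟩)

/-- Only `a ≠ d` has to be assumed: `a = c` or `b = d` would make `a` and `d` adjacent. -/
theorem isIndContained_pathGraph_four {a b c d : V} (hab : G.Adj a b) (hbc : G.Adj b c)
    (hcd : G.Adj c d) (hac : ¬ G.Adj a c) (had : ¬ G.Adj a d) (hbd : ¬ G.Adj b d) (had' : a ≠ d) :
    (SimpleGraph.pathGraph 4).IsIndContained G := by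
  have hac' : a ≠ c := by
    rintro rfl
    exact had hcd
  have hbd' : b ≠ d := by
    rintro rfl
    exact had hab
  have hba := hab.symm
  have hcb := hbc.symm
  have hdc := hcd.symm
  have hca : ¬ G.Adj c a := fun h => hac h.symm
  have hda : ¬ G.Adj d a := fun h => had h.symm
  have hdb : ¬ G.Adj d b := fun h => hbd h.symm
  refine ⟨⟨⟨![a, b, c, d], ?_⟩, ?_⟩⟩
  · intro i j h
    fin_cases i <;> fin_cases j <;>
      simp_all [hab.ne, hbc.ne, hcd.ne, hab.ne', hbc.ne', hcd.ne', hac'.symm, hbd'.symm, had'.symm]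
  · intro i j
    change G.Adj (![a, b, c, d] i) (![a, b, c, d] j) ↔ _
    fin_cases i <;> fin_cases j <;> simp [SimpleGraph.pathGraph_adj, *]

/-- If `a` and `c` were not near, then `a`, `y`, `b`, `c` would be an induced path, since every
chord gives a shorter connection. This is the only use of the cograph hypothesis; it makes `Near`
the relation of lying in the same component. -/
theorem Near.trans_adj (hG : IsCograph G) {a b c : V} (h : Near G a b) (hbc : G.Adj b c) :
    Near G a c := by
  rcases h with rfl | h | ⟨y, h₁, h₂⟩
  · exact Or.inr (Or.inl hbc)
  · exact Or.inr (Or.inr ⟨b, h, hbc⟩)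
  · by_contra hn
    simp only [Near, not_or, not_exists, not_and] at hn
    exact hG (isIndContained_pathGraph_four h₁ h₂ hbc (fun h => hn.2.2 b h hbc) hn.2.1
      (hn.2.2 y h₁) hn.1)

theorem Near.trans (hG : IsCograph G) {a b c : V} (h : Near G a b) (h' : Near G b c) :
    Near G a c := by
  rcases h' with rfl | h' | ⟨y, h₁, h₂⟩
  · exact h
  · exact h.trans_adj hG h'
  · exact (h.trans_adj hG h₁).trans_adj hG h₂

/-- At distance two, the common neighbor has the colors of both `a` and `b`. -/
theorem color_eq_of_near {C : Type} {c : V → C} {a b : V} (ha : IsHappy G c a)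
    (hb : IsHappy G c b) (h : Near G a b) : c a = c b := by
  rcases h with rfl | h | ⟨y, h₁, h₂⟩
  · rfl
  · exact (ha b h).symm
  · exact (ha y h₁).symm.trans (hb y h₂.symm)

end Graph

/-! ### The optimum as a sum over components. -/

section Optimum

variable (I : MHVInstance)

/-- All closed neighbors of `v` are uncolored or have the precolor of `w`. -/
def Good (v w : Fin I.n) : Prop := ∀ u, (u = v ∨ I.graph.Adj v u) → Compat I u w

/-- `i` is the first vertex of its component. -/
def First (i : Fin I.n) : Prop := ∀ j < i, ¬ Near I.graph i j

open Classical in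
/-- The number of vertices in the component of `i` that are happy if all uncolored vertices get
the precolor of `w`. -/
noncomputable def happyCount (i w : Fin I.n) : ℕ :=
  (Finset.univ.filter fun v => Near I.graph i v ∧ Good I v w).card

open Classical in
/-- The greatest number of happy vertices in the component of `i`. -/
noncomputable def best (i : Fin I.n) : ℕ :=
  (Finset.univ.filter fun w => Near I.graph i w).sup (happyCount I i)

theorem best_le (i : Fin I.n) : best I i ≤ I.n :=
  Finset.sup_le fun w _ => (Finset.card_le_univ _).trans (by simp)

variable {I}

/-- The least vertex near `v` represents the component of `v`; together with `First.eq` this gives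
unique representatives. -/
theorem exists_first (hG : IsCograph I.graph) (v : Fin I.n) :
    ∃ i, First I i ∧ Near I.graph i v := by
  classical
  have hne : (Finset.univ.filter fun i => Near I.graph i v).Nonempty :=
    ⟨v, Finset.mem_filter.2 ⟨Finset.mem_univ _, Or.inl rfl⟩⟩
  have hmem := Finset.min'_mem _ hne
  refine ⟨_, fun j hj hij => ?_, (Finset.mem_filter.1 hmem).2⟩
  have := Finset.min'_le (Finset.univ.filter fun i => Near I.graph i v) j
    (by simpa using hij.symm.trans hG (Finset.mem_filter.1 hmem).2)
  exact absurd hj (not_lt.2 this)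

theorem First.eq (hG : IsCograph I.graph) {i j v : Fin I.n} (hi : First I i) (hj : First I j)
    (hiv : Near I.graph i v) (hjv : Near I.graph j v) : i = j := by
  have h := hiv.trans hG hjv.symm
  rcases lt_trichotomy i j with hij | hij | hij
  · exact absurd h.symm (hj i hij)
  · exact hij
  · exact absurd h (hi j hij)

open Classical in
/-- A coloring makes at most `best I i` vertices of the component of `i` happy. -/
theorem card_happy_le (hG : IsCograph I.graph) {c : Fin I.n → Fin I.ℓ}
    (hc : ExtendsColoring I.p c) (i : Fin I.n) :
    (Finset.univ.filter fun v => Near I.graph i v ∧ IsHappy I.graph c v).card ≤ best I i := by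
  rcases Finset.eq_empty_or_nonempty
    (Finset.univ.filter fun v => Near I.graph i v ∧ IsHappy I.graph c v) with h | ⟨v₀, hv₀⟩
  · simp [h]
  simp only [Finset.mem_filter, Finset.mem_univ, true_and] at hv₀
  have hcol : ∀ v, Near I.graph i v → IsHappy I.graph c v →
      ∀ u, (u = v ∨ I.graph.Adj v u) → c u = c v₀ := by
    rintro v hv hhappy u hu
    have h₁ : c v = c v₀ := color_eq_of_near hhappy hv₀.2 (hv.symm.trans hG hv₀.1)
    rcases hu with rfl | hu
    · exact h₁
    · rw [hhappy u hu, h₁]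
  obtain ⟨w, hw, hgood⟩ : ∃ w, Near I.graph i w ∧
      ∀ v, Near I.graph i v → IsHappy I.graph c v → Good I v w := by
    -- If the common color of the happy vertices occurs as a precolor in the component, such a
    -- vertex is `w`. Otherwise the closed neighborhoods of the happy vertices are entirely
    -- uncolored, and any `w` will do, for instance `i`.
    by_cases h : ∃ w, Near I.graph i w ∧ I.p w = some (c v₀)
    · obtain ⟨w, hw, hpw⟩ := h
      refine ⟨w, hw, fun v hv hhappy u hu => ?_⟩
      rcases hpu : I.p u with - | x
      · exact Or.inl hpu
      · right
        rw [hpu, hpw, ← hc u x hpu, hcol v hv hhappy u hu]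
    · refine ⟨i, Or.inl rfl, fun v hv hhappy u hu => Or.inl ?_⟩
      rcases hpu : I.p u with - | x
      · rfl
      · refine absurd ⟨u, ?_, ?_⟩ h
        · rcases hu with rfl | hu
          · exact hv
          · exact hv.trans_adj hG hu
        · rw [hpu, ← hc u x hpu, hcol v hv hhappy u hu]
  refine le_trans (Finset.card_le_card ?_) (Finset.le_sup (f := happyCount I i) (b := w) (by simpa))
  intro v hv
  simp only [Finset.mem_filter, Finset.mem_univ, true_and] at hv ⊢
  exact ⟨hv.1, hgood v hv.1 hv.2⟩

open Classical in
theorem exists_best (i : Fin I.n) : ∃ w, Near I.graph i w ∧ happyCount I i w = best I i := by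
  obtain ⟨w, hw, h⟩ := Finset.exists_mem_eq_sup
    (Finset.univ.filter fun w => Near I.graph i w) 
    ⟨i, Finset.mem_filter.2 ⟨Finset.mem_univ _, Or.inl rfl⟩⟩ (happyCount I i)
  exact ⟨w, by simpa using hw, h.symm⟩

open Classical in
/-- Some coloring makes `best I i` vertices of each component happy. -/
theorem exists_coloring (hG : IsCograph I.graph) (a₀ : Fin I.ℓ) :
    ∃ c : Fin I.n → Fin I.ℓ, ExtendsColoring I.p c ∧ ∀ i, First I i →
      best I i ≤
        (Finset.univ.filter fun v => Near I.graph i v ∧ IsHappy I.graph c v).card := by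
  choose r hr hrv using exists_first hG
  choose b hb hbest using exists_best (I := I)
  -- An uncolored vertex takes the precolor of the optimal vertex `b (r v)` of its component, and
  -- `a₀` if that vertex is uncolored too.
  refine ⟨fun v => (I.p v).getD ((I.p (b (r v))).getD a₀), fun v a h => by simp [h], ?_⟩
  intro i hi
  rw [← hbest i]
  refine Finset.card_le_card fun v hv => ?_
  simp only [Finset.mem_filter, Finset.mem_univ, true_and] at hv ⊢
  refine ⟨hv.1, ?_⟩
  have key : ∀ u, (u = v ∨ I.graph.Adj v u) →
      (I.p u).getD ((I.p (b (r u))).getD a₀) = (I.p (b i)).getD a₀ := by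
    intro u hu
    have hiu : Near I.graph i u := by
      rcases hu with rfl | hu
      · exact hv.1
      · exact hv.1.trans_adj hG hu
    rw [First.eq hG (hr u) hi (hrv u) hiu]
    rcases hv.2 u hu with h | h
    · simp [h]
    · rw [h]
      cases I.p (b i) <;> rfl
  intro u hu
  exact (key u (Or.inr hu)).trans (key v (Or.inl rfl)).symm

open Classical in
-- The happy vertices are partitioned by the representatives of their components. One inequality
-- holds for every coloring, the other for a coloring that is optimal in all components at once.
theorem isYes_iff (hG : IsCograph I.graph) :
    I.IsYes ↔ I.ℓ ≠ 0 ∧ I.k ≤ ∑ i, if First I i then best I i else 0 := by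
  have hcard : ∀ c : Fin I.n → Fin I.ℓ, {v | IsHappy I.graph c v}.ncard =
      ∑ i, if First I i then
        (Finset.univ.filter fun v => Near I.graph i v ∧ IsHappy I.graph c v).card else 0 := by
    intro c
    rw [Set.ncard_eq_toFinset_card', ← Finset.sum_filter, ← Finset.card_biUnion]
    · congr 1
      ext v
      simp only [Set.mem_toFinset, Set.mem_ofPred_eq, Finset.mem_biUnion, Finset.mem_filter,
        Finset.mem_univ, true_and]
      refine ⟨fun h => ?_, fun ⟨_, _, _, h⟩ => h⟩
      obtain ⟨i, hi, hiv⟩ := exists_first hG v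
      exact ⟨i, hi, hiv, h⟩
    · intro i hi j hj hij
      refine Finset.disjoint_left.2 fun v hv hv' => hij ?_
      simp only [Finset.coe_filter, Finset.mem_filter, Finset.mem_univ, true_and,
        Set.mem_ofPred_eq] at hi hj hv hv'
      exact First.eq hG hi hj hv.1 hv'.1
  constructor
  · rintro ⟨c, hc, hk⟩
    rw [hcard] at hk
    refine ⟨?_, hk.trans (Finset.sum_le_sum fun i _ => ?_)⟩
    · intro hℓ
      -- The empty graph has a coloring even without colors, but no happy vertex, and `k` is
      -- positive.
      have hn : I.n ≠ 0 := by
        intro hn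
        have : IsEmpty (Fin I.n) := by rw [hn]; infer_instance
        simp at hk
        exact absurd I.k_pos (by omega)
      have := (c ⟨0, by omega⟩).2
      omega
    · split_ifs
      · exact card_happy_le hG hc i
      · exact le_rfl
  · rintro ⟨hℓ, hk⟩
    obtain ⟨c, hc, h⟩ := exists_coloring hG ⟨0, Nat.pos_of_ne_zero hℓ⟩
    refine ⟨c, hc, hk.trans ?_⟩
    rw [hcard]
    refine Finset.sum_le_sum fun i _ => ?_
    split_ifs with hi
    · exact h i hi
    · exact le_rfl

theorem card_filter_lt {n m : ℕ} (h : m ≤ n) :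
    (Finset.univ.filter fun t : Fin n => (t : ℕ) < m).card = m := by
  rw [Fin.card_filter_val_lt, min_eq_right h]

end Optimum

end MHVMachine

/-! ### The formula for the optimum and the complete program. -/

namespace MHVMachine

open StackProg

namespace Formula

/-- Negation. -/
def neg (φ : Formula) : Formula := nand φ φ

/-- Conjunction. -/
def conj (φ ψ : Formula) : Formula := neg (nand φ ψ)

/-- Disjunction. -/
def disj (φ ψ : Formula) : Formula := nand (neg φ) (neg ψ)

/-- Existential quantification. The variable `7` is always zero. -/
def ex (x : Fin 8) (φ : Formula) : Formula := cnt 7 x φ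

/-- The variables are equal. -/
def equal (i j : Fin 8) : Formula := conj (neg (lt i j)) (neg (lt j i))

/-- The variables are near each other. -/
def near (i j : Fin 8) : Formula :=
  disj (equal i j) (disj (adj i j) (ex 5 (conj (adj i 5) (adj 5 j))))

/-- All closed neighbors of the variable `3` are compatible with the variable `2`. -/
def good : Formula := neg (ex 4 (conj (disj (equal 4 3) (adj 3 4)) (neg (compat 4 2))))

/-- The variable `0` is the first vertex of its component, and the greatest number of happy
vertices in this component is greater than the value of the variable `1`. -/
def main : Formula :=
  conj (neg (ex 6 (conj (lt 6 0) (near 0 6))))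
    (ex 2 (conj (near 0 2) (cnt 1 3 (conj (near 0 3) good))))

theorem wellScoped_main : main.WellScoped := by
  simp [main, conj, neg, ex, near, disj, equal, good, WellScoped, bound]

/-- The variables `0` and `1` belong to the two outer loops, so all bound variables are still zero
when the formula is evaluated. -/
theorem mem_bound_main {x : Fin 8} (hx : x ∈ main.bound) : x ≠ 0 ∧ x ≠ 1 := by
  simp [main, conj, neg, ex, near, disj, equal, good, bound] at hx
  omega

variable {I : MHVInstance} {e : Fin 8 → Fin I.n}

theorem sat_neg {φ : Formula} : Sat I (neg φ) e ↔ ¬ Sat I φ e := by simp [neg, Sat]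

theorem sat_conj {φ ψ : Formula} : Sat I (conj φ ψ) e ↔ Sat I φ e ∧ Sat I ψ e := by
  simp [conj, neg, Sat]

theorem sat_disj {φ ψ : Formula} : Sat I (disj φ ψ) e ↔ Sat I φ e ∨ Sat I ψ e := by
  simp only [disj, neg, Sat]
  tauto

theorem sat_ex {x : Fin 8} {φ : Formula} (he : (e 7 : ℕ) = 0) :
    Sat I (ex x φ) e ↔ ∃ a, Sat I φ (update e x a) := by
  simp [ex, Sat, he, Finset.card_pos, Finset.filter_nonempty_iff]

theorem sat_equal {i j : Fin 8} : Sat I (equal i j) e ↔ e i = e j := by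
  simp only [equal, sat_conj, sat_neg, Sat, not_lt]
  exact ⟨fun h => le_antisymm h.2 h.1, fun h => ⟨h.ge, h.le⟩⟩

theorem sat_near {i j : Fin 8} (he : (e 7 : ℕ) = 0) (hi : i ≠ 5) (hj : j ≠ 5) :
    Sat I (near i j) e ↔ Near I.graph (e i) (e j) := by
  simp [near, sat_disj, sat_equal, sat_ex he, sat_conj, Sat, Near, hi, hj]

theorem sat_good (he : (e 7 : ℕ) = 0) : Sat I good e ↔ Good I (e 3) (e 2) := by
  simp [good, sat_neg, sat_ex he, sat_conj, sat_disj, sat_equal, Sat, Good]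

/-- The maximum need not be computed: `t` is below a supremum iff it is below some member, which is
an existential quantifier over `w`. -/
theorem sat_main (he : (e 7 : ℕ) = 0) :
    Sat I main e ↔ First I (e 0) ∧ (e 1 : ℕ) < best I (e 0) := by
  classical
  have h7 : ∀ x a, x ≠ 7 → ((update e x a 7 : Fin I.n) : ℕ) = 0 := fun x a h => by
    rw [update_of_ne h.symm, he]
  have h77 : ∀ x a y b, x ≠ 7 → y ≠ 7 → ((update (update e x a) y b 7 : Fin I.n) : ℕ) = 0 :=
    fun x a y b h h' => by rw [update_of_ne h'.symm, update_of_ne h.symm, he]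
  rw [main, sat_conj, sat_neg, sat_ex he, sat_ex he]
  refine and_congr ?_ ?_
  · simp only [sat_conj, sat_near (h7 6 _ (by decide)) (i := 0) (j := 6) (by decide) (by decide)]
    simp [Sat, First]
  · simp only [sat_conj, sat_near (h7 2 _ (by decide)) (i := 0) (j := 2) (by decide) (by decide)]
    have hin : ∀ w v, Sat I (conj (near 0 3) good) (update (update e 2 w) 3 v) ↔
        Near I.graph (e 0) v ∧ Good I v w := fun w v => by
      rw [sat_conj, sat_good (h77 2 _ 3 _ (by decide) (by decide)),
        sat_near (h77 2 _ 3 _ (by decide) (by decide)) (by decide) (by decide)]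
      simp
    have hcard : ∀ w, Sat I (cnt 1 3 (conj (near 0 3) good)) (update e 2 w) ↔
        (e 1 : ℕ) < happyCount I (e 0) w := fun w => by
      rw [Sat, happyCount, Finset.filter_congr fun v _ => hin w v]
      simp
    simp only [hcard]
    simp [best, Finset.lt_sup_iff]

end Formula

/-- The body of the main loop. -/
def stepProg : StackProg Stk := Formula.main.prog ⨟ decIfProg

/-- The program that decides Max Happy Vertices on cographs. -/
def mainProg : StackProg Stk := readProg ⨟ forVar 0 (forVar 1 stepProg) ⨟ checkProg

theorem polynomial_eval_mono (T : Polynomial ℕ) {a b : ℕ} (h : a ≤ b) : T.eval a ≤ T.eval b := by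
  rw [Polynomial.eval_eq_sum_range, Polynomial.eval_eq_sum_range]
  gcongr

open Classical in
-- For a representative `i`, exactly `best I i` values of `t` cause a decrement; all of them occur
-- among the vertices because `best I i ≤ I.n`. Thus a sum of maxima is subtracted from `k` in unit
-- steps.
theorem exists_exec_loops : ∃ T : Polynomial ℕ, ∀ (I : MHVInstance),
    Exec (forVar 0 (forVar 1 stepProg))
      (memOf I (fun _ => 0) [] [] ((encodeNat I.k).map Γ'.bit)).stk
      (memOf I (fun _ => 0) [] [] ((decBits^[∑ i, if First I i then best I i else 0]
        (encodeNat I.k)).map Γ'.bit)).stk (T.eval I.encode.length) := by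
  obtain ⟨T, hT⟩ := Formula.main.exists_exec Formula.wellScoped_main
  refine ⟨Polynomial.X * (Polynomial.X * (T + 6 * Polynomial.X + 20) + 10) + 10, fun I => ?_⟩
  have hb : bodyLength I + (encodeNat I.k).length ≤ I.encode.length := by
    rw [encode_eq, bodyLength]
    simp
    omega
  have hn := n_le_bodyLength I
  have hstep : ∀ (i t : Fin I.n) (l : List Bool), l.length ≤ I.encode.length →
      Exec stepProg (memOf I (update (update (fun _ => 0) 0 i) 1 t) [] [] (l.map Γ'.bit)).stk
        (memOf I (update (update (fun _ => 0) 0 i) 1 t) [] []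
          ((decBits^[if First I i ∧ (t : ℕ) < best I i then 1 else 0] l).map Γ'.bit)).stk
        (T.eval I.encode.length + (6 * I.encode.length + 12)) := by
    intro i t l hl
    let e : Fin 8 → Fin I.n := update (update (fun _ => ⟨0, i.pos⟩) 0 i) 1 t
    have he : (fun x => (e x : ℕ)) = update (update (fun _ => 0) 0 (i : ℕ)) 1 (t : ℕ) := by
      simp only [e, coe_update]
    have h₁ := hT I e [] (l.map Γ'.bit) fun x hx => by
      have := Formula.mem_bound_main hx
      simp [e, this]
    have h₂ := exec_decIfProg (l := l) (R := [])
      (m := memOf I (fun x => e x) [] (Γ'.bit (decide (Formula.main.Sat I e)) :: []) (l.map Γ'.bit))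
      rfl rfl rfl
    have hsat : Formula.main.Sat I e ↔ First I i ∧ (t : ℕ) < best I i := by
      rw [Formula.sat_main (by simp [e])]
      simp [e]
    rw [he] at h₁ h₂
    refine (h₁.seq h₂).to ?_ ?_
    · by_cases h : First I i ∧ (t : ℕ) < best I i
      · simp [hsat, h, memOf]
      · simp [hsat, h, memOf]
    · have := polynomial_eval_mono T (show bodyLength I ≤ I.encode.length by omega)
      omega
  have hinner : ∀ (i : Fin I.n) (l : List Bool), l.length ≤ I.encode.length →
      Exec (forVar 1 stepProg) (memOf I (update (fun _ => 0) 0 i) [] [] (l.map Γ'.bit)).stk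
        (memOf I (update (fun _ => 0) 0 i) [] []
          ((decBits^[if First I i then best I i else 0] l).map Γ'.bit)).stk
        (I.n * (T.eval I.encode.length + (6 * I.encode.length + 12) + 6) + 2) := by
    intro i l hl
    refine (exec_forVar_dec I (by simp) _ (hstep i) l hl).to ?_ le_rfl
    have : (∑ t : Fin I.n, if First I i ∧ (t : ℕ) < best I i then 1 else 0) =
        if First I i then best I i else 0 := by
      by_cases h : First I i
      · simp [h, card_filter_lt (best_le I i)]
      · simp [h]
    rw [this]
  refine (exec_forVar_dec I rfl _ hinner _ (by omega)).mono ?_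
  simp only [Polynomial.eval_add, Polynomial.eval_mul, Polynomial.eval_X, Polynomial.eval_ofNat]
  have hN : I.n ≤ I.encode.length := by omega
  set N := I.encode.length
  set E := T.eval N
  calc I.n * (I.n * (E + (6 * N + 12) + 6) + 2 + 6) + 2
      ≤ N * (N * (E + (6 * N + 12) + 6) + 2 + 6) + 2 := by gcongr
    _ ≤ N * (N * (E + 6 * N + 20) + 10) + 10 := by
      have : N * (E + (6 * N + 12) + 6) ≤ N * (E + 6 * N + 20) := Nat.mul_le_mul_left _ (by omega)
      have : N * (N * (E + (6 * N + 12) + 6) + 2 + 6) ≤ N * (N * (E + 6 * N + 20) + 10) :=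
        Nat.mul_le_mul_left _ (by omega)
      omega

end MHVMachine

/-- Max Happy Vertices, restricted to cographs, is solved by a Turing machine in time polynomial
in the length of the input. -/
theorem mainTheorem7 :
    Nonempty (Turing.TM2ComputableInPolyTime
      (fun I : {I : MHVInstance // IsCograph I.graph} => I.1.encode)
      Computability.encodingBoolBool.encode
      (fun I : {I : MHVInstance // IsCograph I.graph} => I.1.answer)) := by
  classical
  obtain ⟨T, hT⟩ := MHVMachine.exists_exec_loops
  refine StackProg.nonempty_polyTime _ _ MHVMachine.mainProg .inp .res
    (T + 100 * Polynomial.X + 100) fun ⟨I, hI⟩ => ?_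
  have h := (MHVMachine.exec_readProg I).seq ((hT I).seq (MHVMachine.exec_checkProg I _))
  refine h.to ?_ ?_
  -- A truncated difference vanishes iff `k` is at most the optimum.
  · have : (decide (I.k - (∑ i, if MHVMachine.First I i then MHVMachine.best I i else 0) = 0) &&
        decide (I.ℓ ≠ 0)) = I.answer := by
      rw [MHVInstance.answer, Bool.eq_iff_iff]
      simp only [Bool.and_eq_true, decide_eq_true_eq, MHVMachine.isYes_iff hI,
        Nat.sub_eq_zero_iff_le]
      exact and_comm
    rw [MHVMachine.natVal_iterate_decBits, MHVMachine.natVal_encodeNat, this]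
  · have h₁ := MHVMachine.length_iterate_decBits_le
      (∑ i, if MHVMachine.First I i then MHVMachine.best I i else 0) (Computability.encodeNat I.k)
    have h₂ : (Computability.encodeNat I.k).length ≤ I.encode.length := by
      rw [MHVMachine.encode_eq]
      simp
      omega
    simp
    omega
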